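/- An $n\times n$ alternating sign matrix (ASM) is a matrix with entries in $\{0,1,-1\}$ such that in every row and every column the nonzero entries alternate in sign and begin and end with $+1$; for $n=0$ there is exactly one, the empty matrix. For an $n\times n$ ASM $A$ let $T(A)=(T_0,\dots,T_n)$ be its monotone triangle: $T_m\subseteq[n]=\{1,\dots,n\}$ is the set whose indicator vector is the sum of the first $m$ rows of $A$, so $\#T_m=m$. For $1\le k\le n-1$ let $T\times\pi_k$ be obtained from $T$ by replacing the row $T_k$ by the componentwise smallest row that still forms a monotone triangle with the other rows, that is, by $\{h_1<\dots<h_k\}$ with $h_m=\max(i_{m-1},j_m)$, where $T_{k-1}=\{i_1<\dots<i_{k-1}\}$, $T_{k+1}=\{j_1<\dots<j_{k+1}\}$ and $i_0=0$. Put $\mathrm{Des}(A)=\{k\in[n-1]: T(A)\times\pi_k\ne T(A)\}$. Let $\mathrm{QSym}\subset\mathbb Z[[x_1,x_2,\dots]]$ be the ring of quasisymmetric functions, with $\mathbb Z$-basis $M_\alpha=\sum_{i_1<\dots<i_k}x_{i_1}^{\alpha_1}\cdots x_{i_k}^{\alpha_k}$ and coproduct $\Delta M_\alpha=\sum_{\alpha=\beta\cdot\gamma}M_\beta\otimes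 M_\gamma$ (sum over deconcatenations); let $L_\alpha=\sum_{\beta\text{ refines }\alpha}M_\beta$, and for $J\subseteq[n-1]$ let $\alpha(J)$ be the composition of $n$ whose proper partial sums are the elements of $J$. Let $\mathrm{FQSym}$ (the Malvenuto–Reutenauer algebra) be the free abelian group on all permutations of $[n]$, $n\ge0$, with product $\mathbf u\cdot\mathbf v=\sum_w\mathbf w$ over all shuffles $w$ of $(u_1,\dots,u_a)$ and $(a+v_1,\dots,a+v_b)$. Let $\mathcal{ASM}$ (the Cheballah–Giraudo–Maurice algebra) be the free abelian group on all ASMs of all sizes $n\ge 0$. The product $\mathbf A\cdot\mathbf B$, for $A$ of size $a$ and $B$ of size $b$, is the sum of all $\mathbf C$ where $C$ is obtained by shuffling the rows of $A$ with $b$ zero columns appended on the right and the rows of $B$ with $a$ zero columns appended on the left. The coproduct is $\Delta\mathbf A=\sum\mathbf A'\otimes\mathbf A''$ over all horizontal cuts of $A$ into a top block and a bottom block (either may be empty) such that deleting the zero columns of each block leaves square matrices $A'$ and $A''$. In both algebras the unit is the basis element of size $0$. Theorem. The linear map $\varphi:\mathcal{ASM}\to\mathrm{QSym}$, $\mathbf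 A\mapsto L_{\alpha(\mathrm{Des}(A))}$, is a morphism of unital algebras. It extends the Malvenuto–Reutenauer map $\mathrm{FQSym}\to\mathrm{QSym}$, $\mathbf w\mapsto L_{\alpha(\mathrm{Des}(w))}$ with $\mathrm{Des}(w)=\{k: w_k>w_{k+1}\}$: the linear map $\mathrm{FQSym}\to\mathcal{ASM}$ sending $\mathbf w$ to the matrix whose $m$-th row has its only nonzero entry, a $1$, in column $w_m$ is an injective morphism of unital algebras, and its composition with $\varphi$ is the Malvenuto–Reutenauer map. The map $\varphi$ is not a coalgebra morphism: $(\varphi\otimes\varphi)\circ\Delta\ne\Delta\circ\varphi$. -/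

import Mathlib

open scoped TensorProduct

noncomputable section

namespace ASMHopf

/-! ### Alternating sign matrices -/

/-- A vector with entries in `{0, 1, -1}` is alternating if its nonzero entries alternate in sign,
beginning and ending with `1` (in particular it has a nonzero entry). -/
def IsAlternating {n : ℕ} (v : Fin n → ℤ) : Prop :=
  (∀ i, v i = 0 ∨ v i = 1 ∨ v i = -1) ∧
  (∀ i j, i < j → v i ≠ 0 → v j ≠ 0 → (∀ k, i < k → k < j → v k = 0) → v j = -v i) ∧
  (∃ i, v i = 1 ∧ ∀ j, j < i → v j = 0) ∧
  (∃ i, v i = 1 ∧ ∀ j, i < j → v j = 0)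

/-- Alternating sign matrices: all rows and all columns are alternating. -/
def IsASM {n : ℕ} (A : Matrix (Fin n) (Fin n) ℤ) : Prop :=
  (∀ i, IsAlternating (fun j => A i j)) ∧ (∀ j, IsAlternating (fun i => A i j))

/-- The set of `n × n` alternating sign matrices; `ASM 0` consists of the empty matrix. -/
abbrev ASM (n : ℕ) : Type := {A : Matrix (Fin n) (Fin n) ℤ // IsASM A}

instance (n : ℕ) : Finite (ASM n) := by
  refine Finite.of_injective
    (fun (A : ASM n) (i j : Fin n) => (⟨A.1 i j, ?_⟩ : Set.Icc (-1 : ℤ) 1)) ?_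
  · rcases (A.2.1 i).1 j with h | h | h <;> simp only [h, Set.mem_Icc] <;> norm_num
  · intro A B h
    apply Subtype.ext
    ext i j
    exact congrArg Subtype.val (congrFun (congrFun h i) j)

instance (n : ℕ) : Fintype (ASM n) := Fintype.ofFinite _

/-- The unique `0 × 0` alternating sign matrix. -/
def emptyASM : ASM 0 := ⟨0, fun i => i.elim0, fun j => j.elim0⟩

/-! ### Monotone triangles and descents

`Fin n` plays the role of `[n] = {1, …, n}`, the element `c : Fin n` having the label `c + 1`. -/

/-- The rows `T_0, T_1, …, T_n` of the monotone triangle of `A`: the set `T_m` is the one whose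
indicator vector is the sum of the first `m` rows of `A`. -/
def triangle {n : ℕ} (A : ASM n) (m : Fin (n + 1)) : Finset (Fin n) :=
  {c | ∑ i with i.1 < m.1, A.1 i c = 1}

/-- The label of the `m`-th smallest element of `S`, for `1 ≤ m ≤ #S`, and `0` for `m = 0`. -/
def entry {n : ℕ} (S : Finset (Fin n)) : ℕ → ℕ
  | 0 => 0
  | m + 1 => ((S.sort (· ≤ ·)).map fun c => (c : ℕ) + 1).getD m 0

open Classical in
/-- For `#I = k` and `#J ≥ k + 2`, the set `{h_1 < ⋯ < h_{k+1}}` with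
`h_m = max (i_{m-1}, j_m)`, where `i_0 = 0`.  It is the componentwise smallest set that can stand
between the rows `I` and `J` of a monotone triangle. -/
def hMin {n : ℕ} (I J : Finset (Fin n)) : Finset (Fin n) :=
  {c | ∃ m ∈ Set.Icc 1 (I.card + 1), (c : ℕ) + 1 = max (entry I (m - 1)) (entry J m)}

/-- The operator `T ↦ T × π_{k+1}`: row number `k + 1` is replaced by the componentwise smallest
row that fits between rows `k` and `k + 2`. -/
def zeroHecke {n : ℕ} (k : Fin (n - 1)) (T : Fin (n + 1) → Finset (Fin n)) :
    Fin (n + 1) → Finset (Fin n) :=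
  Function.update T ⟨k + 1, by omega⟩ (hMin (T ⟨k, by omega⟩) (T ⟨k + 2, by omega⟩))

/-- The descent set of (the rows of) a monotone triangle of size `n`, as a subset of `[n - 1]`;
here `k : Fin (n - 1)` stands for the element `k + 1` of `[n - 1]`. -/
def triangleDes {n : ℕ} (T : Fin (n + 1) → Finset (Fin n)) : Finset (Fin (n - 1)) :=
  {k | zeroHecke k T ≠ T}

/-- The descent set of an alternating sign matrix. -/
def asmDes {n : ℕ} (A : ASM n) : Finset (Fin (n - 1)) := triangleDes (triangle A)

/-- The descent set `{k ∈ [n - 1] : w_k > w_{k+1}}` of a permutation. -/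
def permDes {n : ℕ} (w : Equiv.Perm (Fin n)) : Finset (Fin (n - 1)) :=
  {k | w ⟨k + 1, by omega⟩ < w ⟨k, by omega⟩}

/-! ### Shuffles -/

/-- `w` is a shuffle of the sequences `u` and `v`. -/
def IsShuffle {X : Type} {a b : ℕ} (u : Fin a → X) (v : Fin b → X) (w : Fin (a + b) → X) : Prop :=
  ∃ (f : Fin a ↪o Fin (a + b)) (g : Fin b ↪o Fin (a + b)),
    Disjoint (Set.range f) (Set.range g) ∧ (∀ i, w (f i) = u i) ∧ (∀ j, w (g j) = v j)

/-! ### The Malvenuto–Reutenauer algebra -/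

/-- The free abelian group on all permutations of all sizes. -/
def FQSym : Type := (Σ n : ℕ, Equiv.Perm (Fin n)) →₀ ℤ

namespace FQSym

instance : AddCommGroup FQSym :=
  inferInstanceAs (AddCommGroup ((Σ n : ℕ, Equiv.Perm (Fin n)) →₀ ℤ))

instance : Module ℤ FQSym :=
  inferInstanceAs (Module ℤ ((Σ n : ℕ, Equiv.Perm (Fin n)) →₀ ℤ))

/-- The `ℤ`-basis of `FQSym` indexed by permutations. -/
def basis : Module.Basis (Σ n : ℕ, Equiv.Perm (Fin n)) ℤ FQSym := ⟨LinearEquiv.refl ℤ _⟩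

/-- The basis element of a permutation. -/
def of {n : ℕ} (w : Equiv.Perm (Fin n)) : FQSym := basis ⟨n, w⟩

open Classical in
/-- The product of two basis elements: the sum over all shuffles of `u` and `v[a]`. -/
def shuffleProd {a b : ℕ} (u : Equiv.Perm (Fin a)) (v : Equiv.Perm (Fin b)) : FQSym :=
  ∑ w : Equiv.Perm (Fin (a + b)) with
    IsShuffle (fun i => Fin.castAdd b (u i)) (fun j => Fin.natAdd a (v j)) (fun k => w k), of w

/-- The bilinear extension of the shuffle product. -/
def mulHom : FQSym →ₗ[ℤ] FQSym →ₗ[ℤ] FQSym :=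
  basis.constr ℤ fun u => basis.constr ℤ fun v => shuffleProd u.2 v.2

instance : Mul FQSym := ⟨fun x y => mulHom x y⟩

instance : One FQSym := ⟨of (1 : Equiv.Perm (Fin 0))⟩

end FQSym

/-! ### The algebra (and coalgebra) of alternating sign matrices -/

/-- The free abelian group on all alternating sign matrices of all sizes. -/
def ASMAlg : Type := (Σ n : ℕ, ASM n) →₀ ℤ

namespace ASMAlg

instance : AddCommGroup ASMAlg := inferInstanceAs (AddCommGroup ((Σ n : ℕ, ASM n) →₀ ℤ))

instance : Module ℤ ASMAlg := inferInstanceAs (Module ℤ ((Σ n : ℕ, ASM n) →₀ ℤ))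

/-- The `ℤ`-basis indexed by alternating sign matrices. -/
def basis : Module.Basis (Σ n : ℕ, ASM n) ℤ ASMAlg := ⟨LinearEquiv.refl ℤ _⟩

/-- The basis element of an alternating sign matrix. -/
def of {n : ℕ} (A : ASM n) : ASMAlg := basis ⟨n, A⟩

/-- The rows of `A ∘ b`, that is, of `A` with `b` zero columns appended on the right. -/
def padRight {a : ℕ} (A : ASM a) (b : ℕ) : Fin a → (Fin (a + b) → ℤ) :=
  fun i => Fin.append (fun j => A.1 i j) (fun _ => 0)

/-- The rows of `a ∘ B`, that is, of `B` with `a` zero columns appended on the left. -/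
def padLeft (a : ℕ) {b : ℕ} (B : ASM b) : Fin b → (Fin (a + b) → ℤ) :=
  fun i => Fin.append (fun _ => 0) (fun j => B.1 i j)

open Classical in
/-- The product of two basis elements: the sum of all matrices obtained by shuffling the rows of
`A ∘ b` and of `a ∘ B` (all of which are alternating sign matrices). -/
def shuffleProd {a b : ℕ} (A : ASM a) (B : ASM b) : ASMAlg :=
  ∑ C : ASM (a + b) with IsShuffle (padRight A b) (padLeft a B) (fun i j => C.1 i j), of C

/-- The bilinear extension of the row-shuffle product. -/
def mulHom : ASMAlg →ₗ[ℤ] ASMAlg →ₗ[ℤ] ASMAlg :=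
  basis.constr ℤ fun A => basis.constr ℤ fun B => shuffleProd A.2 B.2

instance : Mul ASMAlg := ⟨fun x y => mulHom x y⟩

instance : One ASMAlg := ⟨of emptyASM⟩

/-- `N` is the matrix obtained from `M` by deleting all zero columns; since `N` is square, this says
that the number of nonzero columns of `M` equals its number of rows. -/
def IsCompression {p n : ℕ} (M : Matrix (Fin p) (Fin n) ℤ) (N : Matrix (Fin p) (Fin p) ℤ) : Prop :=
  ∃ f : Fin p ↪o Fin n, Set.range f = {c | ∃ i, M i c ≠ 0} ∧ ∀ i j, N i j = M i (f j)

/-- The first `p` rows of `A`. -/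
def topRows {n : ℕ} (A : ASM n) (p : Fin (n + 1)) : Matrix (Fin p) (Fin n) ℤ :=
  fun i j => A.1 ⟨i, by omega⟩ j

/-- The last `n - p` rows of `A`. -/
def bottomRows {n : ℕ} (A : ASM n) (p : Fin (n + 1)) : Matrix (Fin (n - p)) (Fin n) ℤ :=
  fun i j => A.1 ⟨p + i, by omega⟩ j

open Classical in
/-- The coproduct of a basis element: the sum over all ways of cutting `A` horizontally into two
blocks both of which become square when their zero columns are deleted (the two square matrices
being then alternating sign matrices). -/
def cutCoprod {n : ℕ} (A : ASM n) : ASMAlg ⊗[ℤ] ASMAlg :=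
  ∑ p : Fin (n + 1), ∑ B : ASM p, ∑ C : ASM (n - p),
    if IsCompression (topRows A p) B.1 ∧ IsCompression (bottomRows A p) C.1
    then of B ⊗ₜ[ℤ] of C else 0

instance : CoalgebraStruct ℤ ASMAlg where
  comul := basis.constr ℤ fun A => cutCoprod A.2
  counit := basis.constr ℤ fun A => if A.1 = 0 then 1 else 0

end ASMAlg

/-- The matrix `A(w)`, whose `m`-th row has its only nonzero entry, a `1`, in column `w_m`. -/
def permASM {n : ℕ} (w : Equiv.Perm (Fin n)) : ASM n :=
  ⟨fun i j => if j = w i then 1 else 0, by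
    have key : ∀ (m : ℕ) (c : Fin m), IsAlternating (fun j : Fin m => if j = c then (1 : ℤ) else 0) := by
      intro m c
      refine ⟨fun i => ?_, fun i j hij hi hj _ => ?_, ⟨c, by simp, fun j hj => if_neg hj.ne⟩,
        ⟨c, by simp, fun j hj => if_neg hj.ne'⟩⟩
      · by_cases h : i = c <;> simp [h]
      · have h1 : i = c := by by_contra h; exact hi (if_neg h)
        have h2 : j = c := by by_contra h; exact hj (if_neg h)
        exact absurd (h1.trans h2.symm) hij.ne
    refine ⟨fun i => key n (w i), fun j => ?_⟩
    convert key n (w.symm j) using 3 with i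
    rw [Equiv.eq_symm_apply, eq_comm]⟩

/-- The linear map `FQSym → ASMAlg` sending a permutation `w` to `A(w)`. -/
def permEmbedding : FQSym →ₗ[ℤ] ASMAlg := FQSym.basis.constr ℤ fun w => ASMAlg.of (permASM w.2)

/-! ### Quasisymmetric functions -/

/-- Compositions of all natural numbers: finite sequences of positive integers. -/
abbrev Comp : Type := {l : List ℕ // ∀ a ∈ l, 0 < a}

open Classical in
/-- The formal power series `∑_{i_1 < ⋯ < i_k} x_{i_1}^{α_1} ⋯ x_{i_k}^{α_k}` in `x_0, x_1, …`. -/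
def monomialSeries (α : Comp) : MvPowerSeries ℕ ℤ := fun d =>
  if ∃ i : Fin α.1.length → ℕ, StrictMono i ∧ d = ∑ t, Finsupp.single (i t) (α.1.get t)
  then 1 else 0

lemma sum_single_eq {k : ℕ} (i : Fin k → ℕ) (v : Fin k → ℕ) :
    ∑ t, Finsupp.single (i t) (v t) = Finsupp.mapDomain i (Finsupp.equivFunOnFinite.symm v) := by
  rw [Finsupp.mapDomain, Finsupp.sum_fintype _ _ (by simp)]
  rfl

lemma mem_support_sum_single {k : ℕ} {i : Fin k → ℕ} (hi : StrictMono i) {v : Fin k → ℕ}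
    (hv : ∀ t, 0 < v t) (c : ℕ) :
    c ∈ (∑ t, Finsupp.single (i t) (v t)).support ↔ ∃ t, i t = c := by
  rw [sum_single_eq]
  constructor
  · intro h
    by_contra hc
    rw [Finsupp.mem_support_iff] at h
    exact h (Finsupp.mapDomain_of_notMem_range _ _ (by simpa using hc))
  · rintro ⟨t, rfl⟩
    rw [Finsupp.mem_support_iff, Finsupp.mapDomain_apply hi.injective]
    exact (hv t).ne'

lemma comp_pos (α : Comp) (t : Fin α.1.length) : 0 < α.1.get t := α.2 _ (List.get_mem _ _)

lemma monomialSeries_mapDomain (α : Comp) {k : ℕ} {i i' : Fin k → ℕ} (hi : StrictMono i)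
    (hi' : StrictMono i') (p : Fin k →₀ ℕ) :
    monomialSeries α (p.mapDomain i) = monomialSeries α (p.mapDomain i') := by
  classical
  have key : ∀ {i i' : Fin k → ℕ}, StrictMono i → StrictMono i' →
      (∃ j : Fin α.1.length → ℕ, StrictMono j ∧
        p.mapDomain i = ∑ t, Finsupp.single (j t) (α.1.get t)) →
      (∃ j : Fin α.1.length → ℕ, StrictMono j ∧
        p.mapDomain i' = ∑ t, Finsupp.single (j t) (α.1.get t)) := by
    rintro i i' hi hi' ⟨j, hj, h⟩
    have h1 : ∀ t, ∃ s, i s = j t := by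
      intro t
      have : j t ∈ (p.mapDomain i).support := by
        rw [h, mem_support_sum_single hj (comp_pos α)]; exact ⟨t, rfl⟩
      by_contra hc
      rw [Finsupp.mem_support_iff] at this
      exact this (Finsupp.mapDomain_of_notMem_range _ _ (by simpa using hc))
    choose s hs using h1
    have hp : p = Finsupp.mapDomain s (Finsupp.equivFunOnFinite.symm α.1.get) := by
      apply Finsupp.mapDomain_injective hi.injective
      rw [h, sum_single_eq, ← Finsupp.mapDomain_comp]
      congr 1
      funext t
      exact (hs t).symm
    have hsm : StrictMono s := fun x y hxy => by
      rw [← hi.lt_iff_lt, hs, hs]; exact hj hxy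
    refine ⟨i' ∘ s, hi'.comp hsm, ?_⟩
    rw [sum_single_eq, Finsupp.mapDomain_comp, ← hp]
  unfold monomialSeries
  exact if_congr ⟨key hi hi', key hi' hi⟩ rfl rfl

lemma comp_unique {α β : Comp} {i : Fin α.1.length → ℕ} {j : Fin β.1.length → ℕ}
    (hi : StrictMono i) (hj : StrictMono j)
    (h : ∑ t, Finsupp.single (i t) (α.1.get t) = ∑ t, Finsupp.single (j t) (β.1.get t)) :
    α = β := by
  have hr : Set.range i = Set.range j := by
    ext c
    rw [Set.mem_range, Set.mem_range, ← mem_support_sum_single hi (comp_pos α), h,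
      mem_support_sum_single hj (comp_pos β)]
  have hl : α.1.length = β.1.length := by
    have := congrArg Set.ncard hr
    rwa [← Set.image_univ, ← Set.image_univ, Set.ncard_image_of_injective _ hi.injective,
      Set.ncard_image_of_injective _ hj.injective, Set.ncard_univ, Set.ncard_univ, Nat.card_fin,
      Nat.card_fin] at this
  obtain ⟨l, hlpos⟩ := α
  obtain ⟨l', hlpos'⟩ := β
  dsimp only at hl i j hi hj hr h
  apply Subtype.ext
  dsimp only
  have hij : ∀ t : Fin l.length, i t = j (Fin.cast hl t) := by
    have h2 : StrictMono (fun t : Fin l.length => j (Fin.cast hl t)) :=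
      fun x y hxy => hj (by simpa using hxy)
    have h3 : Set.range i = Set.range (fun t : Fin l.length => j (Fin.cast hl t)) := by
      rw [hr]
      ext c
      constructor
      · rintro ⟨t, rfl⟩; exact ⟨Fin.cast hl.symm t, by simp⟩
      · rintro ⟨t, rfl⟩; exact ⟨Fin.cast hl t, rfl⟩
    exact fun t => congrFun ((StrictMono.range_inj hi h2).1 h3) t
  apply List.ext_get hl
  intro m h1 h2
  have := DFunLike.congr_fun h (i ⟨m, h1⟩)
  rw [sum_single_eq, sum_single_eq, Finsupp.mapDomain_apply hi.injective, hij,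
    Finsupp.mapDomain_apply hj.injective] at this
  exact this

lemma monomialSeries_self (α : Comp) :
    monomialSeries α (∑ t : Fin α.1.length, Finsupp.single (t : ℕ) (α.1.get t)) = 1 := by
  unfold monomialSeries
  exact if_pos ⟨_, Fin.val_strictMono, rfl⟩

lemma monomialSeries_ne {α β : Comp} (h : β ≠ α) :
    monomialSeries β (∑ t : Fin α.1.length, Finsupp.single (t : ℕ) (α.1.get t)) = 0 := by
  unfold monomialSeries
  refine if_neg ?_
  rintro ⟨j, hj, e⟩
  exact h (comp_unique hj Fin.val_strictMono e.symm)

lemma linearIndependent_monomialSeries : LinearIndependent ℤ monomialSeries := by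
  rw [linearIndependent_iff']
  intro s c hc α hα
  have := congrArg (MvPowerSeries.coeff (∑ t : Fin α.1.length, Finsupp.single (t : ℕ) (α.1.get t))) hc
  rw [map_sum, map_zero, Finset.sum_eq_single α] at this
  · rw [map_smul] at this
    change c α * monomialSeries α _ = 0 at this
    rwa [monomialSeries_self, mul_one] at this
  · intro β _ hβ
    rw [map_smul]
    change c β * monomialSeries β _ = 0
    rw [monomialSeries_ne hβ, mul_zero]
  · exact fun h => absurd hα h

lemma exists_comp (d : ℕ →₀ ℕ) : ∃ (α : Comp) (i : Fin α.1.length → ℕ), StrictMono i ∧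
    d = ∑ t, Finsupp.single (i t) (α.1.get t) := by
  have hpos : ∀ a ∈ List.ofFn (fun t => d (d.support.orderEmbOfFin rfl t)), 0 < a := by
    intro a ha
    rw [List.mem_ofFn] at ha
    obtain ⟨t, rfl⟩ := ha
    exact Nat.pos_of_ne_zero (Finsupp.mem_support_iff.1 (Finset.orderEmbOfFin_mem _ _ _))
  have hlen := List.length_ofFn (f := fun t => d (d.support.orderEmbOfFin rfl t))
  refine ⟨⟨_, hpos⟩, fun t => d.support.orderEmbOfFin rfl (Fin.cast hlen t), ?_, ?_⟩
  · intro x y hxy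
    exact (d.support.orderEmbOfFin rfl).strictMono (by simpa using hxy)
  · have h1 : d = ∑ t, Finsupp.single (d.support.orderEmbOfFin rfl t)
        (d (d.support.orderEmbOfFin rfl t)) := by
      conv_lhs => rw [← Finsupp.sum_single d, Finsupp.sum]
      conv_lhs => rw [← Finset.image_orderEmbOfFin_univ d.support rfl]
      rw [Finset.sum_image (fun x _ y _ h => (d.support.orderEmbOfFin rfl).injective h)]
    conv_lhs => rw [h1]
    refine (Fintype.sum_equiv (finCongr hlen) _ _ fun t => ?_).symm
    dsimp only [finCongr_apply]
    rw [List.get_ofFn]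
    rfl

lemma degree_of_monomialSeries_ne_zero {α : Comp} {d : ℕ →₀ ℕ} (h : monomialSeries α d ≠ 0) :
    d.degree = α.1.sum := by
  unfold monomialSeries at h
  have h1 := of_not_not fun hc => h (if_neg hc)
  obtain ⟨i, -, rfl⟩ := h1
  rw [map_sum]
  simp only [Finsupp.degree_single]
  simp [← List.sum_ofFn]

lemma monomialSeries_mul_mapDomain (α β : Comp) {k : ℕ} {i i' : Fin k → ℕ} (hi : StrictMono i)
    (hi' : StrictMono i') (p : Fin k →₀ ℕ) :
    MvPowerSeries.coeff (p.mapDomain i) (monomialSeries α * monomialSeries β) =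
      MvPowerSeries.coeff (p.mapDomain i') (monomialSeries α * monomialSeries β) := by
  classical
  have key : ∀ {i : Fin k → ℕ}, StrictMono i →
      MvPowerSeries.coeff (p.mapDomain i) (monomialSeries α * monomialSeries β) =
        ∑ x ∈ Finset.HasAntidiagonal.antidiagonal p,
          monomialSeries α (x.1.mapDomain i) * monomialSeries β (x.2.mapDomain i) := by
    intro i hi
    rw [MvPowerSeries.coeff_mul]
    symm
    refine Finset.sum_bij (fun x _ => (x.1.mapDomain i, x.2.mapDomain i)) ?_ ?_ ?_ ?_
    · intro x hx
      rw [Finset.HasAntidiagonal.mem_antidiagonal] at hx ⊢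
      rw [← Finsupp.mapDomain_add, hx]
    · intro x _ y _ h
      rw [Prod.mk.injEq] at h
      exact Prod.ext (Finsupp.mapDomain_injective hi.injective h.1)
        (Finsupp.mapDomain_injective hi.injective h.2)
    · rintro ⟨y, z⟩ h
      rw [Finset.HasAntidiagonal.mem_antidiagonal] at h
      dsimp only at h
      have hs : ∀ c, y c ≠ 0 ∨ z c ≠ 0 → c ∈ Set.range i := by
        intro c hc
        by_contra hn
        have := DFunLike.congr_fun h c
        rw [Finsupp.mapDomain_of_notMem_range _ _ hn, Finsupp.add_apply] at this
        omega
      have hy : (y.comapDomain i hi.injective.injOn).mapDomain i = y :=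
        Finsupp.mapDomain_comapDomain i hi.injective y
          fun c hc => hs c (Or.inl (Finsupp.mem_support_iff.1 hc))
      have hz : (z.comapDomain i hi.injective.injOn).mapDomain i = z :=
        Finsupp.mapDomain_comapDomain i hi.injective z
          fun c hc => hs c (Or.inr (Finsupp.mem_support_iff.1 hc))
      refine ⟨(y.comapDomain i hi.injective.injOn, z.comapDomain i hi.injective.injOn), ?_, ?_⟩
      · rw [Finset.HasAntidiagonal.mem_antidiagonal]
        apply Finsupp.mapDomain_injective hi.injective
        rw [Finsupp.mapDomain_add, hy, hz, h]
      · rw [hy, hz]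
    · intro x _
      rfl
  rw [key hi, key hi']
  refine Finset.sum_congr rfl fun x _ => ?_
  rw [monomialSeries_mapDomain α hi hi', monomialSeries_mapDomain β hi hi']

/-- A composition of `n`, regarded as a composition of some natural number. -/
def compOf {n : ℕ} (c : Composition n) : Comp := ⟨c.blocks, fun _ h => c.blocks_pos h⟩

lemma monomialSeries_mul_mem (α β : Comp) :
    monomialSeries α * monomialSeries β ∈ Submodule.span ℤ (Set.range monomialSeries) := by
  classical
  set f := monomialSeries α * monomialSeries β with hf
  have hdeg : ∀ d, MvPowerSeries.coeff d f ≠ 0 → d.degree = α.1.sum + β.1.sum := by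
    intro d hd
    rw [hf, MvPowerSeries.coeff_mul] at hd
    obtain ⟨x, hx, h⟩ := Finset.exists_ne_zero_of_sum_ne_zero hd
    rw [Finset.HasAntidiagonal.mem_antidiagonal] at hx
    rw [← hx, map_add, degree_of_monomialSeries_ne_zero (left_ne_zero_of_mul h),
      degree_of_monomialSeries_ne_zero (right_ne_zero_of_mul h)]
  let D : Comp → (ℕ →₀ ℕ) := fun γ => ∑ t : Fin γ.1.length, Finsupp.single (t : ℕ) (γ.1.get t)
  have hsum : f = ∑ γ : Composition (α.1.sum + β.1.sum),
      MvPowerSeries.coeff (D (compOf γ)) f • monomialSeries (compOf γ) := by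
    ext d
    obtain ⟨δ, i, hi, hd⟩ := exists_comp d
    have hMd : ∀ γ : Comp, MvPowerSeries.coeff d (monomialSeries γ) = if γ = δ then 1 else 0 := by
      intro γ
      have : MvPowerSeries.coeff d (monomialSeries γ) = monomialSeries γ (D δ) := by
        change monomialSeries γ d = _
        rw [hd]
        dsimp only [D]
        rw [sum_single_eq, sum_single_eq]
        exact monomialSeries_mapDomain γ hi Fin.val_strictMono _
      rw [this]
      split_ifs with h
      · subst h; exact monomialSeries_self _
      · exact monomialSeries_ne h
    have hfd : MvPowerSeries.coeff d f = MvPowerSeries.coeff (D δ) f := by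
      rw [hd]
      dsimp only [D]
      rw [sum_single_eq, sum_single_eq]
      exact monomialSeries_mul_mapDomain α β hi Fin.val_strictMono _
    rw [map_sum]
    simp only [map_zsmul, hMd, smul_eq_mul, mul_ite, mul_one, mul_zero]
    by_cases hN : δ.1.sum = α.1.sum + β.1.sum
    · let γ0 : Composition (α.1.sum + β.1.sum) := ⟨δ.1, fun h => δ.2 _ h, hN⟩
      rw [Finset.sum_eq_single γ0]
      · rw [if_pos (show compOf γ0 = δ from rfl), hfd]
        rfl
      · intro γ _ hγ
        refine if_neg fun h => hγ ?_
        ext1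
        exact congrArg Subtype.val h
      · simp
    · rw [Finset.sum_eq_zero]
      · by_contra h0
        apply hN
        rw [← hdeg d h0, hd, map_sum]
        simp only [Finsupp.degree_single]
        simp [← List.sum_ofFn]
      · intro γ _
        refine if_neg fun h => hN ?_
        rw [← h]
        exact γ.blocks_sum
  rw [hsum]
  exact Submodule.sum_mem _ fun γ _ =>
    Submodule.smul_mem _ _ (Submodule.subset_span ⟨_, rfl⟩)

lemma monomialSeries_nil : monomialSeries ⟨[], by simp⟩ = 1 := by
  classical
  ext d
  rw [MvPowerSeries.coeff_one]
  change monomialSeries _ d = _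
  unfold monomialSeries
  refine if_congr ⟨fun ⟨i, _, h⟩ => ?_, fun h => ⟨fun t => t.elim0, fun t => t.elim0, ?_⟩⟩ rfl rfl
  · rw [h]; rfl
  · rw [h]; rfl

/-- The ring of quasisymmetric functions over `ℤ`: the subalgebra of `ℤ⟦x_0, x_1, …⟧` whose
underlying group is spanned by the monomial quasisymmetric functions. -/
def QSym : Subalgebra ℤ (MvPowerSeries ℕ ℤ) :=
  (Submodule.span ℤ (Set.range monomialSeries)).toSubalgebra
    (monomialSeries_nil ▸ Submodule.subset_span ⟨_, rfl⟩)
    (fun x y hx hy => by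
      induction hx, hy using Submodule.span_induction₂ with
      | mem_mem x y hx hy =>
        obtain ⟨α, rfl⟩ := hx
        obtain ⟨β, rfl⟩ := hy
        exact monomialSeries_mul_mem α β
      | zero_left y _ => rw [zero_mul]; exact Submodule.zero_mem _
      | zero_right x _ => rw [mul_zero]; exact Submodule.zero_mem _
      | add_left x y z _ _ _ h1 h2 => rw [add_mul]; exact Submodule.add_mem _ h1 h2
      | add_right x y z _ _ _ h1 h2 => rw [mul_add]; exact Submodule.add_mem _ h1 h2
      | smul_left r x y _ _ h => rw [smul_mul_assoc]; exact Submodule.smul_mem _ _ h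
      | smul_right r x y _ _ h => rw [mul_smul_comm]; exact Submodule.smul_mem _ _ h)

namespace QSym

/-- The `ℤ`-basis of `QSym` given by the monomial quasisymmetric functions. -/
def basis : Module.Basis Comp ℤ QSym := Module.Basis.span linearIndependent_monomialSeries

/-- The monomial quasisymmetric function `M_α`. -/
def M (α : Comp) : QSym := basis α

lemma coe_M (α : Comp) : (M α : MvPowerSeries ℕ ℤ) = monomialSeries α :=
  congrArg Subtype.val (Module.Basis.span_apply linearIndependent_monomialSeries α)

/-- Gessel's fundamental quasisymmetric function `L_α`: the sum of `M_β` over all compositions `β`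
of the same number that refine `α`. -/
def L {n : ℕ} (α : Composition n) : QSym :=
  ∑ β : Composition n with α.boundaries ⊆ β.boundaries, M (compOf β)

/-- The composition of `n` whose partial sums, apart from `0` and `n`, are the elements of the
subset `J` of `[n - 1]`; here `j : Fin (n - 1)` stands for the element `j + 1` of `[n - 1]`. -/
def compOfSet {n : ℕ} (J : Finset (Fin (n - 1))) : Composition n :=
  (compositionEquiv n).symm ((compositionAsSetEquiv n).symm J)

/-- The coproduct of `M_α`: the sum of `M_β ⊗ M_γ` over all `β, γ` with concatenation `α`. -/
def deconcat (α : Comp) : QSym ⊗[ℤ] QSym :=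
  ∑ k ∈ Finset.range (α.1.length + 1),
    M ⟨α.1.take k, fun a h => α.2 a (List.mem_of_mem_take h)⟩ ⊗ₜ[ℤ]
      M ⟨α.1.drop k, fun a h => α.2 a (List.mem_of_mem_drop h)⟩

instance : CoalgebraStruct ℤ QSym where
  comul := basis.constr ℤ deconcat
  counit := basis.constr ℤ fun α => if α.1 = [] then 1 else 0

end QSym

/-- The Malvenuto–Reutenauer map `w ↦ L_{α(Des(w))}`. -/
def permDesMap : FQSym →ₗ[ℤ] QSym :=
  FQSym.basis.constr ℤ fun w => QSym.L (QSym.compOfSet (permDes w.2))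

/-- The map `A ↦ L_{α(Des(A))}`. -/
def asmDesMap : ASMAlg →ₗ[ℤ] QSym :=
  ASMAlg.basis.constr ℤ fun A => QSym.L (QSym.compOfSet (asmDes A.2))

end ASMHopf

end

noncomputable section

namespace ASMHopf

/-! ### Prefix sums of alternating vectors -/

/-! Descents of alternating sign matrices are local, and they shuffle like descents of permutations.
All prefix sums of an alternating row are 0 or 1. A row of the monotone triangle is determined by
its counting function (the number of elements below `c`), and the prefix sums are the increments of
these functions from one row to the next. The smallest row between `I` and `J` has counting function
min(count I + 1, count J) (`countBelow_hMin`). Hence a descent occurs at two adjacent rows of the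
matrix exactly when, for some `c`, the upper prefix sum is 0 and the lower one is 1 (`mem_asmDes`).
For permutation matrices this is the usual descent condition.

In a shuffle of padded rows, two adjacent rows of the same matrix behave as they do in that matrix.
A row of `A` directly above a row of `B` never gives a descent, and the opposite order always does
(`asmDes_shuffledASM`). So the descent sets occurring in a product depend only on the two given
descent sets, and multiplicativity reduces to the shuffle rule for fundamental quasisymmetric
functions (`L_mul_L`). There, `L` is the generating function of weakly increasing sequences with
forced strict steps (`coeff_L`), and two sequences merge in exactly one way once ties are broken in
favour of the first (`compatible_shuffle_iff`).

The coproducts disagree on the 3 × 3 matrix with an entry -1. Cutting below its first row leaves two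
rows with three nonzero columns, so its coproduct has no term of bidegree (1, 2). But the coproduct
of every `L` of degree 3 contains M_1 ⊗ M_11. -/

/-- The sum of the entries of `v` in positions before `c`. -/
def prefixSum {n : ℕ} (v : Fin n → ℤ) (c : ℕ) : ℤ := ∑ j with j.1 < c, v j

lemma prefixSum_zero {n : ℕ} (v : Fin n → ℤ) : prefixSum v 0 = 0 := by
  simp [prefixSum]

lemma prefixSum_succ {n : ℕ} (v : Fin n → ℤ) (c : Fin n) :
    prefixSum v (c.1 + 1) = prefixSum v c.1 + v c := by
  have : (Finset.univ.filter fun j : Fin n => j.1 < c.1 + 1) =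
      insert c (Finset.univ.filter fun j : Fin n => j.1 < c.1) := by
    ext j
    simp only [Finset.mem_filter, Finset.mem_univ, true_and, Finset.mem_insert, Fin.ext_iff]
    omega
  rw [prefixSum, this, Finset.sum_insert (by simp), add_comm]
  rfl

lemma prefixSum_of_le {n : ℕ} (v : Fin n → ℤ) {c : ℕ} (h : n ≤ c) :
    prefixSum v c = ∑ j, v j := by
  rw [prefixSum, Finset.filter_true_of_mem fun j _ => j.2.trans_le h]

/-- The second conjunct strengthens the induction: the prefix sum fixes the sign of the next nonzero
entry, +1 after 0 and -1 after 1, so the sum stays in {0, 1}. -/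
lemma IsAlternating.prefixSum_aux {n : ℕ} {v : Fin n → ℤ} (hv : IsAlternating v) (c : ℕ) :
    c ≤ n → (prefixSum v c = 0 ∨ prefixSum v c = 1) ∧
      ∀ i : Fin n, c ≤ i.1 → v i ≠ 0 → (∀ k : Fin n, c ≤ k.1 → k < i → v k = 0) →
        v i = 1 - 2 * prefixSum v c := by
  obtain ⟨-, h2, ⟨i₀, hi₀, hi₀'⟩, -⟩ := hv
  induction c with
  | zero =>
    intro _
    rw [prefixSum_zero]
    refine ⟨Or.inl rfl, fun i _ hi hk => ?_⟩
    rcases lt_trichotomy i i₀ with h | h | h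
    · exact absurd (hi₀' i h) hi
    · rw [h, hi₀]; norm_num
    · rw [hk i₀ (Nat.zero_le _) h] at hi₀; norm_num at hi₀
  | succ c ih =>
    intro hc
    obtain ⟨ih1, ih2⟩ := ih (by omega)
    have hs := prefixSum_succ v ⟨c, by omega⟩
    dsimp only at hs
    by_cases h0 : v ⟨c, by omega⟩ = 0
    · rw [hs, h0, add_zero]
      refine ⟨ih1, fun i hi hvi hk => ih2 i (by omega) hvi fun k hk1 hk2 => ?_⟩
      rcases hk1.eq_or_lt with h | h
      · rw [← h0]; exact congrArg v (Fin.ext h.symm)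
      · exact hk k h hk2
    · have hvc := ih2 ⟨c, by omega⟩ le_rfl h0 (fun k h1 h2 => absurd h2 (not_lt.2 h1))
      rw [hs, hvc]
      refine ⟨by omega, fun i hi hvi hk => ?_⟩
      rw [h2 ⟨c, by omega⟩ i hi h0 hvi (fun k hk1 hk2 => hk k hk1 hk2), hvc]
      ring

lemma IsAlternating.prefixSum_eq {n : ℕ} {v : Fin n → ℤ} (hv : IsAlternating v) (c : ℕ) :
    prefixSum v c = 0 ∨ prefixSum v c = 1 := by
  rcases le_total c n with h | h
  · exact (hv.prefixSum_aux c h).1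
  · rw [prefixSum_of_le v h, ← prefixSum_of_le v le_rfl]
    exact (hv.prefixSum_aux n le_rfl).1

/-- The last nonzero entry is 1, and prefix sums lie in {0, 1}, so they must jump from 0 to 1 there.
-/
lemma IsAlternating.sum_eq_one {n : ℕ} {v : Fin n → ℤ} (hv : IsAlternating v) :
    ∑ j, v j = 1 := by
  obtain ⟨i, hi, hi'⟩ := hv.2.2.2
  have h1 := prefixSum_succ v i
  have h2 : ∑ j, v j = prefixSum v (i.1 + 1) := by
    rw [prefixSum]
    refine (Finset.sum_subset (Finset.subset_univ _) fun j _ hj => hi' j ?_).symm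
    simpa [Nat.lt_iff_add_one_le] using hj
  have h3 := hv.prefixSum_eq i.1
  have h4 := hv.prefixSum_eq (i.1 + 1)
  omega

/-! ### Counting functions of finite sets and of the rows of monotone triangles -/

/-- The number of elements of `S` that are less than `c`. -/
def countBelow {n : ℕ} (S : Finset (Fin n)) (c : ℕ) : ℕ := (S.filter fun x => x.1 < c).card

lemma countBelow_le {n : ℕ} (S : Finset (Fin n)) (c : ℕ) : countBelow S c ≤ S.card :=
  Finset.card_filter_le _ _

lemma countBelow_succ {n : ℕ} (S : Finset (Fin n)) (x : Fin n) :
    countBelow S (x.1 + 1) = countBelow S x.1 + if x ∈ S then 1 else 0 := by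
  have : (S.filter fun y => y.1 < x.1 + 1) =
      (S.filter fun y => y.1 < x.1) ∪ S.filter fun y => y = x := by
    ext y
    simp only [Finset.mem_filter, Finset.mem_union, Fin.ext_iff, ← and_or_left,
      Nat.lt_succ_iff_lt_or_eq]
  rw [countBelow, this, Finset.card_union_of_disjoint, Finset.filter_eq']
  · congr 1
    split_ifs <;> simp
  · rw [Finset.disjoint_left]
    intro y h1 h2
    simp only [Finset.mem_filter] at h1 h2
    rw [h2.2] at h1
    exact lt_irrefl _ h1.2

lemma eq_iff_countBelow {n : ℕ} {S T : Finset (Fin n)} :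
    S = T ↔ ∀ c, countBelow S c = countBelow T c := by
  refine ⟨fun h c => by rw [h], fun h => ?_⟩
  ext x
  have h1 := countBelow_succ S x
  have h2 := countBelow_succ T x
  rw [h, h x.1] at h1
  rw [h2] at h1
  by_cases hS : x ∈ S <;> by_cases hT : x ∈ T <;> simp_all

lemma entry_succ {n : ℕ} (S : Finset (Fin n)) (m : Fin S.card) :
    entry S (m.1 + 1) = (S.orderEmbOfFin rfl m).1 + 1 := by
  -- In `entry` the cast to `ℕ` appears as a monadic bind over the whole list; this rewrites it as a
  -- second `List.map`.
  have h : ∀ l : List (Fin n), (do let a ← l; pure a.1 : List ℕ) = l.map fun a => a.1 :=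
    fun l => by rw [List.map_eq_flatMap]; rfl
  rw [entry, h, Finset.orderEmbOfFin_apply, List.getD_eq_getElem _ _ (by simp), List.getElem_map,
    List.getElem_map]
  rfl

/-- A Galois connection between entries and counting functions. Labels are positions plus one, so
`≤` for labels becomes `<` for positions; the positions below `c` form an initial segment of the
sorted set. -/
lemma entry_le_iff {n : ℕ} (S : Finset (Fin n)) {m : ℕ} (hm : m ≤ S.card) (c : ℕ) :
    entry S m ≤ c ↔ m ≤ countBelow S c := by
  rcases m with _ | m
  · simp [entry]
  rw [entry_succ S ⟨m, hm⟩]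
  set F := S.orderEmbOfFin rfl with hF
  have hcard : countBelow S c = (Finset.univ.filter fun t : Fin S.card => (F t).1 < c).card := by
    rw [countBelow]
    conv_lhs => rw [← Finset.image_orderEmbOfFin_univ S rfl]
    rw [Finset.filter_image, Finset.card_image_of_injective _ F.injective]
  rw [hcard, Nat.succ_le_iff]
  constructor
  · intro h
    rw [Nat.succ_le_iff, ← Nat.succ_le_iff]
    have : (Finset.Iic (⟨m, hm⟩ : Fin S.card)).card ≤
        (Finset.univ.filter fun t : Fin S.card => (F t).1 < c).card := by
      refine Finset.card_le_card fun t ht => ?_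
      rw [Finset.mem_Iic] at ht
      simp only [Finset.mem_filter, Finset.mem_univ, true_and]
      exact lt_of_le_of_lt (F.monotone ht) h
    simpa using this
  · intro h
    by_contra hc
    have : (Finset.univ.filter fun t : Fin S.card => (F t).1 < c).card ≤
        (Finset.Iio (⟨m, hm⟩ : Fin S.card)).card := by
      refine Finset.card_le_card fun t ht => ?_
      simp only [Finset.mem_filter, Finset.mem_univ, true_and] at ht
      rw [Finset.mem_Iio]
      by_contra hlt
      exact hc (lt_of_le_of_lt (F.monotone (not_lt.1 hlt)) ht)
    simp at this
    omega

lemma entry_lt_entry {n : ℕ} (S : Finset (Fin n)) {m m' : ℕ} (h : m < m') (h' : m' ≤ S.card) :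
    entry S m < entry S m' := by
  obtain ⟨m', rfl⟩ : ∃ k, m' = k + 1 := ⟨m' - 1, by omega⟩
  rw [entry_succ S ⟨m', h'⟩]
  rcases m with _ | m
  · simp [entry]
  · rw [entry_succ S ⟨m, by omega⟩]
    have : S.orderEmbOfFin rfl ⟨m, by omega⟩ < S.orderEmbOfFin rfl ⟨m', h'⟩ :=
      (S.orderEmbOfFin rfl).strictMono (by simpa using h)
    exact Nat.succ_lt_succ this

lemma entry_le {n : ℕ} (S : Finset (Fin n)) {m : ℕ} (hm : m ≤ S.card) : entry S m ≤ n := by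
  rw [entry_le_iff S hm]
  refine hm.trans (le_of_eq ?_)
  rw [countBelow, Finset.filter_true_of_mem fun x _ => x.2]

/-- By `entry_le_iff`, h_m ≤ c means m - 1 ≤ count I and m ≤ count J. The h_m increase strictly, so
counting them amounts to counting the admissible m. -/
lemma countBelow_hMin {n : ℕ} (I J : Finset (Fin n)) (h : I.card + 1 ≤ J.card) (c : ℕ) :
    countBelow (hMin I J) c = min (countBelow I c + 1) (countBelow J c) := by
  classical
  set F : ℕ → ℕ := fun m => max (entry I (m - 1)) (entry J m) with hF
  have hinj : Set.InjOn F (Finset.Icc 1 (min (countBelow I c + 1) (countBelow J c))) := by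
    have hIc := countBelow_le I c
    have : StrictMonoOn F (Finset.Icc 1 (min (countBelow I c + 1) (countBelow J c))) := by
      intro m hm m' hm' hlt
      simp only [Finset.coe_Icc, Set.mem_Icc, le_min_iff] at hm hm'
      exact max_lt_max (entry_lt_entry I (by omega) (by omega))
        (entry_lt_entry J hlt (by omega))
    exact this.injOn
  have himg : ((hMin I J).filter fun x => x.1 < c).image (fun x => x.1 + 1) =
      (Finset.Icc 1 (min (countBelow I c + 1) (countBelow J c))).image F := by
    ext y
    have hIc := countBelow_le I c
    simp only [Finset.mem_image, Finset.mem_filter, hMin, Finset.mem_univ, true_and, Set.mem_Icc,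
      Finset.mem_Icc, le_min_iff]
    constructor
    · rintro ⟨x, ⟨⟨m, ⟨hm1, hm2⟩, hx⟩, hxc⟩, rfl⟩
      have hle : max (entry I (m - 1)) (entry J m) ≤ c := by omega
      rw [max_le_iff, entry_le_iff I (by omega), entry_le_iff J (by omega)] at hle
      exact ⟨m, ⟨hm1, by omega, hle.2⟩, hx.symm⟩
    · rintro ⟨m, ⟨hm1, hm2, hm3⟩, rfl⟩
      have hle : max (entry I (m - 1)) (entry J m) ≤ c := by
        rw [max_le_iff, entry_le_iff I (by omega), entry_le_iff J (by omega)]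
        exact ⟨by omega, hm3⟩
      have hn : max (entry I (m - 1)) (entry J m) ≤ n :=
        max_le (entry_le I (by omega)) (entry_le J (by omega))
      have hpos : 0 < max (entry I (m - 1)) (entry J m) :=
        lt_max_of_lt_right (entry_lt_entry J (m := 0) hm1 (by omega))
      refine ⟨⟨max (entry I (m - 1)) (entry J m) - 1, by omega⟩,
        ⟨⟨m, ⟨hm1, by omega⟩, ?_⟩, ?_⟩, ?_⟩ <;> dsimp only [F] <;> omega
  have hcard := congrArg Finset.card himg
  rw [Finset.card_image_of_injective _ (fun x y hxy => by simpa [Fin.ext_iff] using hxy),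
    Finset.card_image_of_injOn hinj, Nat.card_Icc] at hcard
  rw [countBelow, hcard]
  omega

/-! ### Rows of the monotone triangle and the local descent criterion. -/

lemma countBelow_triangle {n : ℕ} (A : ASM n) (m : Fin (n + 1)) (c : ℕ) :
    (countBelow (triangle A m) c : ℤ) = ∑ i with i.1 < m.1, prefixSum (A.1 i) c := by
  have hsum : ∑ i with i.1 < m.1, prefixSum (A.1 i) c =
      ∑ j with j.1 < c, ∑ i with i.1 < m.1, A.1 i j := Finset.sum_comm
  rw [hsum, countBelow, Finset.card_filter, triangle, Finset.sum_filter,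
    Finset.sum_filter]
  push_cast
  refine Finset.sum_congr rfl fun j _ => ?_
  -- The partial column sums are 0 or 1, hence equal to the indicator of the row of the triangle.
  have := (A.2.2 j).prefixSum_eq m.1
  rw [prefixSum] at this
  by_cases h : j.1 < c
  · rw [if_pos h, if_pos h]
    rcases this with h | h <;> simp [h]
  · rw [if_neg h, if_neg h]; simp

lemma card_triangle {n : ℕ} (A : ASM n) (m : Fin (n + 1)) : (triangle A m).card = m.1 := by
  have h := countBelow_triangle A m n
  have h1 : countBelow (triangle A m) n = (triangle A m).card := by
    rw [countBelow, Finset.filter_true_of_mem fun x _ => x.2]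
  simp only [prefixSum_of_le _ le_rfl] at h
  rw [h1, Finset.sum_congr rfl fun i _ => (A.2.1 i).sum_eq_one] at h
  rw [Finset.sum_const, nsmul_eq_mul, mul_one, Nat.cast_inj] at h
  rw [h, Fin.card_filter_val_lt]
  exact min_eq_right (by omega)

lemma countBelow_triangle_succ {n : ℕ} (A : ASM n) (m : ℕ) (hm : m < n) (c : ℕ) :
    (countBelow (triangle A ⟨m + 1, by omega⟩) c : ℤ) =
      countBelow (triangle A ⟨m, by omega⟩) c + prefixSum (A.1 ⟨m, hm⟩) c := by
  rw [countBelow_triangle, countBelow_triangle]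
  exact prefixSum_succ (fun i => prefixSum (A.1 i) c) ⟨m, hm⟩

/-- A position is a descent of `A` exactly if some prefix sum vanishes in the upper one of the two
rows, but not in the lower one. -/
lemma mem_asmDes {n : ℕ} (A : ASM n) (k : Fin (n - 1)) :
    k ∈ asmDes A ↔ ∃ c, prefixSum (A.1 ⟨k, by omega⟩) c = 0 ∧
      prefixSum (A.1 ⟨k + 1, by omega⟩) c = 1 := by
  have hk := k.2
  rw [asmDes, triangleDes, Finset.mem_filter, zeroHecke, Ne, Function.update_eq_self_iff,
    eq_iff_countBelow]
  simp only [Finset.mem_univ, true_and, not_forall]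
  refine exists_congr fun c => ?_
  rw [countBelow_hMin _ _ (by rw [card_triangle, card_triangle]; dsimp only; omega)]
  have h1 := countBelow_triangle_succ A k.1 (by omega) c
  have h2 : (countBelow (triangle A ⟨k.1 + 2, by omega⟩) c : ℤ) = _ :=
    countBelow_triangle_succ A (k.1 + 1) (by omega) c
  have h3 : prefixSum (A.1 ⟨k.1, by omega⟩) c = 0 ∨ prefixSum (A.1 ⟨k.1, by omega⟩) c = 1 :=
    (A.2.1 ⟨k.1, by omega⟩).prefixSum_eq c
  have h4 : prefixSum (A.1 ⟨k.1 + 1, by omega⟩) c = 0 ∨ prefixSum (A.1 ⟨k.1 + 1, by omega⟩) c = 1 :=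
    (A.2.1 ⟨k.1 + 1, by omega⟩).prefixSum_eq c
  -- With x the count of the upper set and p, q ∈ {0, 1} the two prefix sums, x + p ≠ min (x + 1, x
  -- + p + q) holds only for p = 0, q = 1.
  omega

lemma prefixSum_permASM {n : ℕ} (w : Equiv.Perm (Fin n)) (i : Fin n) (c : ℕ) :
    prefixSum ((permASM w).1 i) c = if (w i).1 < c then 1 else 0 := by
  simp [prefixSum, permASM, Finset.sum_ite_eq']

lemma asmDes_permASM {n : ℕ} (w : Equiv.Perm (Fin n)) : asmDes (permASM w) = permDes w := by
  ext k
  rw [mem_asmDes, permDes, Finset.mem_filter]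
  simp only [prefixSum_permASM, Finset.mem_univ, true_and, Fin.lt_def]
  constructor
  · rintro ⟨c, h1, h2⟩
    by_contra h
    split_ifs at h1 h2
    all_goals omega
  · intro h
    -- The cut is just before the entry 1 of the upper row.
    refine ⟨(w ⟨k, by omega⟩).1, by simp, if_pos h⟩

/-! ### Fundamental quasisymmetric functions as generating functions of sequences -/

/-- The exponent of the monomial `x_{f 0} x_{f 1} ⋯`. -/
def content {ι : Type*} [Fintype ι] (f : ι → ℕ) : ℕ →₀ ℕ := ∑ i, Finsupp.single (f i) 1

lemma content_apply {ι : Type*} [Fintype ι] (f : ι → ℕ) (c : ℕ) :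
    content f c = (Finset.univ.filter fun i => f i = c).card := by
  rw [content, Finsupp.finsetSum_apply, Finset.card_filter]
  exact Finset.sum_congr rfl fun i _ => Finsupp.single_apply

lemma content_comp_equiv {ι κ : Type*} [Fintype ι] [Fintype κ] (e : ι ≃ κ) (f : κ → ℕ) :
    content (f ∘ e) = content f :=
  Fintype.sum_equiv e _ _ fun _ => rfl

lemma content_sumElim {ι κ : Type*} [Fintype ι] [Fintype κ] (f : ι → ℕ) (g : κ → ℕ) :
    content (Sum.elim f g) = content f + content g := by
  simp [content]

lemma degree_content {ι : Type*} [Fintype ι] (f : ι → ℕ) :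
    (content f).degree = Fintype.card ι := by
  simp [content, map_sum]

/-- A weakly increasing sequence is determined by its multiset of values: `f i < c` exactly when `i`
is less than the number of values below `c`. -/
lemma eq_of_content_eq {n : ℕ} {f g : Fin n → ℕ} (hf : Monotone f) (hg : Monotone g)
    (h : content f = content g) : f = g := by
  have key : ∀ {f : Fin n → ℕ}, Monotone f → ∀ (i : Fin n) (c : ℕ),
      f i < c ↔ i.1 < ∑ x ∈ Finset.range c, content f x := by
    intro f hf i c
    have hcard : ∑ x ∈ Finset.range c, content f x =
        (Finset.univ.filter fun i => f i < c).card := by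
      rw [Finset.card_eq_sum_card_fiberwise (f := f) (t := Finset.range c)]
      · refine Finset.sum_congr rfl fun x hx => ?_
        rw [content_apply, Finset.filter_filter]
        congr 1
        ext j
        simp only [Finset.mem_filter, Finset.mem_univ, true_and]
        rw [Finset.mem_range] at hx
        omega
      · intro j hj
        simpa using hj
    rw [hcard]
    constructor
    · intro hi
      have : (Finset.Iic i).card ≤ (Finset.univ.filter fun i => f i < c).card := by
        refine Finset.card_le_card fun j hj => ?_
        rw [Finset.mem_Iic] at hj
        simpa using (hf hj).trans_lt hi
      simpa [Nat.succ_le_iff] using this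
    · intro hi
      by_contra hc
      have : (Finset.univ.filter fun i => f i < c).card ≤ (Finset.Iio i).card := by
        refine Finset.card_le_card fun j hj => ?_
        rw [Finset.mem_Iio]
        by_contra hij
        exact hc ((hf (not_lt.1 hij)).trans_lt (by simpa using hj))
      simp at this
      omega
  funext i
  refine eq_of_forall_lt_iff fun c => ?_
  rw [← Nat.not_le, ← Nat.not_le, ← Nat.lt_succ_iff, ← Nat.lt_succ_iff, key hf, key hg, h]

/-- The weakly increasing sequences that increase strictly at the positions in `J`. -/
def Compatible {n : ℕ} (J : Finset (Fin (n - 1))) (f : Fin n → ℕ) : Prop :=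
  Monotone f ∧ ∀ k ∈ J, f ⟨k, by omega⟩ < f ⟨k + 1, by omega⟩

/-- The compatible sequences with a given content. -/
abbrev CompatibleSeq {n : ℕ} (J : Finset (Fin (n - 1))) (d : ℕ →₀ ℕ) : Type :=
  {f : Fin n → ℕ // Compatible J f ∧ content f = d}

instance {n : ℕ} (J : Finset (Fin (n - 1))) (d : ℕ →₀ ℕ) : Subsingleton (CompatibleSeq J d) :=
  ⟨fun f g => Subtype.ext (eq_of_content_eq f.2.1.1 g.2.1.1 (f.2.2.trans g.2.2.symm))⟩

/-! ### Compositions as block structures on positions. -/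

/-- The number of the block of `β` that contains a position. -/
def blockIndex {n : ℕ} (β : Composition n) (k : Fin n) : Fin β.blocks.length := β.index k

/-- The sequence that is constant on each block realizes the monomial in which each part of `β` is
an exponent. -/
lemma content_comp_blockIndex {n : ℕ} (β : Composition n) (i : Fin β.blocks.length → ℕ) :
    content (i ∘ blockIndex β) = ∑ t, Finsupp.single (i t) (β.blocks.get t) := by
  rw [content]
  rw [← Fintype.sum_equiv β.blocksFinEquiv
    (fun x => Finsupp.single (i x.1) 1) _ (fun x => ?_), Fintype.sum_sigma]
  · refine Finset.sum_congr rfl fun t _ => ?_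
    refine (Finset.sum_const (Finsupp.single (i t) 1)).trans ?_
    rw [Finset.card_univ, Fintype.card_fin, Finsupp.smul_single, smul_eq_mul, mul_one]
    rfl
  · have : blockIndex β (β.blocksFinEquiv x) = x.1 := by
      exact β.index_embedding x.1 x.2
    rw [Function.comp_apply, this]

lemma blockIndex_monotone {n : ℕ} (β : Composition n) : Monotone (blockIndex β) := by
  intro j k hjk
  by_contra hlt
  rw [not_le] at hlt
  have h1 : k.1 < β.sizeUpTo ((β.index k).1 + 1) := β.lt_sizeUpTo_index_succ k
  have h2 := β.sizeUpTo_index_le j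
  have h3 : β.sizeUpTo ((β.index k).1 + 1) ≤ β.sizeUpTo (β.index j).1 :=
    β.monotone_sizeUpTo hlt
  have h4 : j.1 ≤ k.1 := hjk
  omega

lemma mem_boundaries_iff {n : ℕ} (β : Composition n) (k : ℕ) (hk : k + 1 < n) :
    (⟨k + 1, by omega⟩ : Fin (n + 1)) ∈ β.boundaries ↔
      blockIndex β ⟨k, by omega⟩ < blockIndex β ⟨k + 1, hk⟩ := by
  have h1 : k < β.sizeUpTo ((β.index ⟨k, by omega⟩).1 + 1) :=
    β.lt_sizeUpTo_index_succ ⟨k, by omega⟩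
  have h2 : β.sizeUpTo (β.index ⟨k + 1, hk⟩).1 ≤ k + 1 := β.sizeUpTo_index_le _
  have h3 : k + 1 < β.sizeUpTo ((β.index ⟨k + 1, hk⟩).1 + 1) :=
    β.lt_sizeUpTo_index_succ ⟨k + 1, hk⟩
  have h4 : β.sizeUpTo (β.index ⟨k, by omega⟩).1 ≤ k := β.sizeUpTo_index_le _
  rw [Composition.boundaries, Finset.mem_map]
  constructor
  · rintro ⟨t, -, ht⟩
    have ht' : β.sizeUpTo t.1 = k + 1 := congrArg Fin.val ht
    have a1 : (β.index ⟨k, by omega⟩).1 < t.1 := by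
      by_contra hc
      have := β.monotone_sizeUpTo (not_lt.1 hc)
      omega
    have a2 : t.1 ≤ (β.index ⟨k + 1, hk⟩).1 := by
      by_contra hc
      have : β.sizeUpTo ((β.index ⟨k + 1, hk⟩).1 + 1) ≤ β.sizeUpTo t.1 :=
        β.monotone_sizeUpTo (not_le.1 hc)
      omega
    exact Fin.lt_def.2 (a1.trans_le a2)
  · intro hlt
    have hlt' : (β.index ⟨k, by omega⟩).1 + 1 ≤ (β.index ⟨k + 1, hk⟩).1 := hlt
    have h5 := β.monotone_sizeUpTo hlt'
    have h6 : β.sizeUpTo (β.index ⟨k + 1, hk⟩).1 = k + 1 := by omega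
    exact ⟨(β.index ⟨k + 1, hk⟩).castSucc, Finset.mem_univ _, Fin.ext h6⟩

lemma blockIndex_strict {n : ℕ} (β : Composition n) {f : Fin n → ℕ}
    {i : Fin β.blocks.length → ℕ} (hi : StrictMono i) (hf : f = i ∘ blockIndex β) (k : ℕ)
    (hk : k + 1 < n) : f ⟨k, by omega⟩ < f ⟨k + 1, hk⟩ ↔
      (⟨k + 1, by omega⟩ : Fin (n + 1)) ∈ β.boundaries := by
  rw [mem_boundaries_iff β k hk, hf]
  exact hi.lt_iff_lt

lemma mem_boundaries_compOfSet {n : ℕ} (J : Finset (Fin (n - 1))) (t : Fin (n + 1)) :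
    t ∈ (QSym.compOfSet J).boundaries ↔
      t.1 = 0 ∨ t.1 = n ∨ ∃ k ∈ J, k.1 + 1 = t.1 := by
  have h : (QSym.compOfSet J).boundaries = ((compositionAsSetEquiv n).symm J).boundaries := by
    rw [← Composition.toCompositionAsSet_boundaries]
    exact congrArg CompositionAsSet.boundaries
      ((compositionEquiv n).apply_symm_apply ((compositionAsSetEquiv n).symm J))
  rw [h, compositionAsSetEquiv]
  simp only [Equiv.coe_fn_symm_mk, Set.mem_toFinset, Set.mem_ofPred_eq, Fin.ext_iff, Fin.val_zero,
    Fin.val_last, exists_prop]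
  simp [eq_comm]

/-- Only the elements of `J` matter, since 0 and `n` are boundaries of every composition. -/
lemma boundaries_compOfSet_subset {n : ℕ} (J : Finset (Fin (n - 1))) (β : Composition n) :
    (QSym.compOfSet J).boundaries ⊆ β.boundaries ↔
      ∀ k ∈ J, (⟨k.1 + 1, by omega⟩ : Fin (n + 1)) ∈ β.boundaries := by
  constructor
  · intro h k hk
    apply h
    rw [mem_boundaries_compOfSet]
    exact Or.inr (Or.inr ⟨k, hk, rfl⟩)
  · intro h t ht
    rw [mem_boundaries_compOfSet] at ht
    rcases ht with ht | ht | ⟨k, hk, ht⟩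
    · rw [show t = 0 from Fin.ext ht]
      exact β.toCompositionAsSet.zero_mem
    · rw [show t = Fin.last n from Fin.ext ht]
      exact β.toCompositionAsSet.getLast_mem
    · rw [show t = ⟨k.1 + 1, by omega⟩ from Fin.ext ht.symm]
      exact h k hk

lemma compOf_injective {n : ℕ} : Function.Injective (compOf (n := n)) := by
  intro β γ h
  ext1
  exact congrArg Subtype.val h

/-- Both sides are 0 or 1. The exponent `d` comes from a single composition, so at most one `M`
contributes; the only candidate sequence is constant on the blocks of that composition, and it is
compatible with `J` exactly when the composition refines that of `J`. -/
lemma coeff_L {n : ℕ} (J : Finset (Fin (n - 1))) (d : ℕ →₀ ℕ) :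
    MvPowerSeries.coeff d (QSym.L (QSym.compOfSet J) : MvPowerSeries ℕ ℤ) =
      Nat.card (CompatibleSeq J d) := by
  classical
  have hL : MvPowerSeries.coeff d (QSym.L (QSym.compOfSet J) : MvPowerSeries ℕ ℤ) =
      ∑ β : Composition n with (QSym.compOfSet J).boundaries ⊆ β.boundaries,
        monomialSeries (compOf β) d := by
    rw [QSym.L, AddSubmonoidClass.coe_finsetSum, map_sum]
    refine Finset.sum_congr rfl fun β _ => ?_
    rw [QSym.coe_M]
    rfl
  rw [hL]
  by_cases hne : Nonempty (CompatibleSeq J d)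
  · obtain ⟨f, ⟨hf, hJ⟩, hfd⟩ := hne
    have : Unique (CompatibleSeq J d) := uniqueOfSubsingleton ⟨f, ⟨hf, hJ⟩, hfd⟩
    rw [Nat.card_unique, Nat.cast_one]
    obtain ⟨δ, i, hi, hd⟩ := exists_comp d
    have hn : δ.1.sum = n := by
      have h1 := degree_content f
      rw [hfd, hd, map_sum, Fintype.card_fin] at h1
      rw [← h1]
      simp only [Finsupp.degree_single]
      simp [← List.sum_ofFn]
    let γ : Composition n := ⟨δ.1, fun h => δ.2 _ h, hn⟩
    have hγ : compOf γ = δ := rfl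
    have hfi : f = i ∘ blockIndex γ := by
      refine eq_of_content_eq hf (hi.monotone.comp (blockIndex_monotone γ)) ?_
      rw [hfd, hd]
      exact (content_comp_blockIndex γ i).symm
    rw [Finset.sum_eq_single γ]
    · unfold monomialSeries
      exact if_pos ⟨i, hi, hd⟩
    · intro β _ hβ
      unfold monomialSeries
      refine if_neg ?_
      rintro ⟨j, hj, hdj⟩
      exact hβ (compOf_injective ((comp_unique hj hi (hdj.symm.trans hd)).trans hγ.symm))
    · intro h
      refine absurd (Finset.mem_filter.2 ⟨Finset.mem_univ _, ?_⟩) h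
      rw [boundaries_compOfSet_subset]
      intro k hk
      exact (blockIndex_strict γ hi hfi k.1 (by omega)).1 (hJ k hk)
  · rw [not_nonempty_iff] at hne
    rw [Nat.card_of_isEmpty, Nat.cast_zero]
    refine Finset.sum_eq_zero fun β hβ => ?_
    rw [Finset.mem_filter, boundaries_compOfSet_subset] at hβ
    unfold monomialSeries
    refine if_neg ?_
    rintro ⟨i, hi, hd⟩
    refine hne.elim ⟨i ∘ blockIndex β, ⟨hi.monotone.comp (blockIndex_monotone β), fun k hk => ?_⟩,
      ?_⟩
    · exact (blockIndex_strict β hi rfl k.1 (by omega)).2 (hβ.2 k hk)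
    · exact (content_comp_blockIndex β i).trans hd.symm

/-! ### The product of two fundamental quasisymmetric functions -/

/-- The ways of shuffling a sequence of length `a` with a sequence of length `b`. -/
abbrev Shuffle (a b : ℕ) : Type :=
  {e : Fin a ⊕ Fin b ≃ Fin (a + b) //
    StrictMono (fun i => e (Sum.inl i)) ∧ StrictMono (fun j => e (Sum.inr j))}

instance (a b : ℕ) : Fintype (Shuffle a b) := Fintype.ofFinite _

/-- Whether two adjacent letters of a shuffle form a descent, where `J` and `K` are the descent sets
of the two sequences, and the letters of the second sequence exceed those of the first one. -/
def LetterDes {a b : ℕ} (J : Finset (Fin (a - 1))) (K : Finset (Fin (b - 1))) :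
    Fin a ⊕ Fin b → Fin a ⊕ Fin b → Prop
  | Sum.inl i, Sum.inl _ => ∃ k ∈ J, k.1 = i.1
  | Sum.inr j, Sum.inr _ => ∃ k ∈ K, k.1 = j.1
  | Sum.inl _, Sum.inr _ => False
  | Sum.inr _, Sum.inl _ => True

open Classical in
/-- The descent set of a shuffle. -/
def shuffleDes {a b : ℕ} (e : Shuffle a b) (J : Finset (Fin (a - 1))) (K : Finset (Fin (b - 1))) :
    Finset (Fin (a + b - 1)) :=
  {k | LetterDes J K (e.1.symm ⟨k, by omega⟩) (e.1.symm ⟨k + 1, by omega⟩)}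

lemma mem_shuffleDes {a b : ℕ} {e : Shuffle a b} {J : Finset (Fin (a - 1))}
    {K : Finset (Fin (b - 1))} {k : Fin (a + b - 1)} : k ∈ shuffleDes e J K ↔
      LetterDes J K (e.1.symm ⟨k, by omega⟩) (e.1.symm ⟨k + 1, by omega⟩) := by
  simp [shuffleDes]

lemma strictMono_of_lt_next {n : ℕ} {X : Type*} [Preorder X] {f : Fin n → X}
    (h : ∀ (k : ℕ) (hk : k + 1 < n), f ⟨k, by omega⟩ < f ⟨k + 1, hk⟩) : StrictMono f := by
  cases n with
  | zero => exact Subsingleton.strictMono f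
  | succ m => exact Fin.strictMono_iff_lt_succ.2 fun i => h i.1 (by omega)

/-- Letters of one sequence that are neighbours in a shuffle were already neighbours in that
sequence. -/
lemma next_of_strictMono {n m : ℕ} {f : Fin n → Fin m} (hf : StrictMono f) {i i' : Fin n}
    (h : (f i').1 = (f i).1 + 1) : i'.1 = i.1 + 1 := by
  have h1 : i < i' := hf.lt_iff_lt.1 (Fin.lt_def.2 (by omega))
  by_contra hne
  have h2 : i < ⟨i.1 + 1, by omega⟩ := Fin.lt_def.2 (Nat.lt_succ_self _)
  have h3 : (⟨i.1 + 1, by omega⟩ : Fin n) < i' := Fin.lt_def.2 (by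
    have : i.1 < i'.1 := h1
    dsimp only
    omega)
  have h4 : (f i).1 < (f ⟨i.1 + 1, by omega⟩).1 := hf h2
  have h5 : (f ⟨i.1 + 1, by omega⟩).1 < (f i').1 := hf h3
  omega

/-! ### Merging two weakly increasing sequences. -/

section SortKey

variable {a b : ℕ}

/-- The key by which the letters of two sequences are merged: ties are broken in favour of the
first sequence. -/
def sortKey (f : Fin a → ℕ) (g : Fin b → ℕ) (x : Fin a ⊕ Fin b) : ℕ ×ₗ (Fin a ⊕ₗ Fin b) :=
  toLex (Sum.elim f g x, toLex x)

lemma sortKey_lt {f : Fin a → ℕ} {g : Fin b → ℕ} {x y : Fin a ⊕ Fin b} :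
    sortKey f g x < sortKey f g y ↔ Sum.elim f g x < Sum.elim f g y ∨
      Sum.elim f g x = Sum.elim f g y ∧ toLex x < toLex y :=
  Prod.Lex.toLex_lt_toLex

lemma sortKey_injective (f : Fin a → ℕ) (g : Fin b → ℕ) : Function.Injective (sortKey f g) := by
  intro x y h
  exact congrArg (fun p : ℕ ×ₗ (Fin a ⊕ₗ Fin b) => ofLex (ofLex p).2) h

lemma exists_shuffle {f : Fin a → ℕ} {g : Fin b → ℕ} (hf : Monotone f) (hg : Monotone g) :
    ∃ e : Shuffle a b, StrictMono (fun k => sortKey f g (e.1.symm k)) := by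
  have hcard : Fintype.card (Set.range (sortKey f g)) = a + b := by
    rw [Set.card_range_of_injective (sortKey_injective f g)]
    simp
  let E : Fin (a + b) ≃o Set.range (sortKey f g) := monoEquivOfFin _ hcard
  let R : Fin a ⊕ Fin b ≃ Set.range (sortKey f g) :=
    Equiv.ofInjective _ (sortKey_injective f g)
  have hR : ∀ x y, sortKey f g x < sortKey f g y → E.symm (R x) < E.symm (R y) :=
    fun x y h => E.symm.strictMono h
  refine ⟨⟨R.trans E.symm.toEquiv, fun i i' h => ?_, fun j j' h => ?_⟩, fun k k' h => ?_⟩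
  · refine hR _ _ (sortKey_lt.2 ?_)
    rcases (hf h.le).lt_or_eq with h1 | h1
    · exact Or.inl h1
    · exact Or.inr ⟨h1, Sum.Lex.inl_lt_inl_iff.2 h⟩
  · refine hR _ _ (sortKey_lt.2 ?_)
    rcases (hg h.le).lt_or_eq with h1 | h1
    · exact Or.inl h1
    · exact Or.inr ⟨h1, Sum.Lex.inr_lt_inr_iff.2 h⟩
  · have hE : ∀ k, sortKey f g (R.symm (E k)) = (E k).1 := fun k =>
      congrArg Subtype.val (R.apply_symm_apply (E k))
    change sortKey f g (R.symm (E k)) < sortKey f g (R.symm (E k'))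
    rw [hE, hE]
    exact E.strictMono h

/-- Both shuffles list the same finite set of keys in increasing order, and the keys are distinct.
-/
lemma shuffle_unique {f : Fin a → ℕ} {g : Fin b → ℕ} {e e' : Shuffle a b}
    (h : StrictMono (fun k => sortKey f g (e.1.symm k)))
    (h' : StrictMono (fun k => sortKey f g (e'.1.symm k))) : e = e' := by
  have hr : ∀ e : Shuffle a b,
      Set.range (fun k => sortKey f g (e.1.symm k)) = Set.range (sortKey f g) :=
    fun e => e.1.symm.surjective.range_comp (sortKey f g)
  have := (StrictMono.range_inj h h').1 ((hr e).trans (hr e').symm)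
  apply Subtype.ext
  apply Equiv.symm_bijective.injective
  ext1 k
  exact sortKey_injective f g (congrFun this k)

/-- The core of the product rule. Where a letter of the second sequence is followed by one of the
first, the shuffle has a descent, so the values must increase strictly; this is exactly the rule
that ties favour the first sequence. -/
lemma compatible_shuffle_iff (e : Shuffle a b) (J : Finset (Fin (a - 1)))
    (K : Finset (Fin (b - 1))) (f : Fin a → ℕ) (g : Fin b → ℕ) :
    Compatible (shuffleDes e J K) (Sum.elim f g ∘ e.1.symm) ↔
      Compatible J f ∧ Compatible K g ∧ StrictMono (fun k => sortKey f g (e.1.symm k)) := by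
  obtain ⟨e, hea, heb⟩ := e
  have nexta : ∀ {k : ℕ} {hk : k < a + b} {hk' : k + 1 < a + b} {i i' : Fin a},
      e.symm ⟨k, hk⟩ = Sum.inl i → e.symm ⟨k + 1, hk'⟩ = Sum.inl i' → i'.1 = i.1 + 1 := by
    intro k hk hk' i i' h h'
    rw [Equiv.symm_apply_eq] at h h'
    exact next_of_strictMono hea (by rw [← h, ← h'])
  have nextb : ∀ {k : ℕ} {hk : k < a + b} {hk' : k + 1 < a + b} {i i' : Fin b},
      e.symm ⟨k, hk⟩ = Sum.inr i → e.symm ⟨k + 1, hk'⟩ = Sum.inr i' → i'.1 = i.1 + 1 := by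
    intro k hk hk' i i' h h'
    rw [Equiv.symm_apply_eq] at h h'
    exact next_of_strictMono heb (by rw [← h, ← h'])
  constructor
  · rintro ⟨hm, hD⟩
    have hs : StrictMono (fun k => sortKey f g (e.symm k)) := by
      refine strictMono_of_lt_next fun k hk => sortKey_lt.2 ?_
      have hle : Sum.elim f g (e.symm ⟨k, by omega⟩) ≤ Sum.elim f g (e.symm ⟨k + 1, hk⟩) :=
        hm (Fin.le_def.2 (Nat.le_succ k))
      rcases hle.lt_or_eq with h | h
      · exact Or.inl h
      refine Or.inr ⟨h, ?_⟩
      rcases hx : e.symm ⟨k, by omega⟩ with i | j <;> rcases hy : e.symm ⟨k + 1, hk⟩ with i' | j'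
      · exact Sum.Lex.inl_lt_inl_iff.2 (Fin.lt_def.2 (by rw [nexta hx hy]; omega))
      · exact Sum.Lex.inl_lt_inr _ _
      -- A tie in the order second-then-first is excluded by the forced descent.
      · refine absurd h (ne_of_lt (hD ⟨k, by omega⟩ ?_))
        rw [mem_shuffleDes]
        dsimp only
        rw [hx, hy]
        trivial
      · exact Sum.Lex.inr_lt_inr_iff.2 (Fin.lt_def.2 (by rw [nextb hx hy]; omega))
    have hfm : Monotone f := by
      intro i i' h
      simpa using hm (hea.monotone h)
    have hgm : Monotone g := by
      intro i i' h
      simpa using hm (heb.monotone h)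
    refine ⟨⟨hfm, fun k hk => ?_⟩, ⟨hgm, fun k hk => ?_⟩, hs⟩
    -- The letters `k` and `k + 1` need not be adjacent in the shuffle. If they are, the shuffle has
    -- a descent at `p`. Otherwise a letter of the second sequence follows `p`, and the values
    -- increase strictly on the way from it to `q`, by the tie rule.
    · have hpq : e (Sum.inl ⟨k, by omega⟩) < e (Sum.inl ⟨k + 1, by omega⟩) :=
        hea (Fin.lt_def.2 (Nat.lt_succ_self _))
      set p := e (Sum.inl ⟨k, by omega⟩) with hp
      set q := e (Sum.inl ⟨k + 1, by omega⟩) with hq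
      have hpx : e.symm ⟨p.1, p.2⟩ = Sum.inl ⟨k, by omega⟩ := by rw [Equiv.symm_apply_eq]
      have hqx : e.symm q = Sum.inl ⟨k + 1, by omega⟩ := by rw [Equiv.symm_apply_eq]
      have hp1 : p.1 + 1 < a + b := by have := q.2; have : p.1 < q.1 := hpq; omega
      have hle : (⟨p.1 + 1, hp1⟩ : Fin (a + b)) ≤ q := hpq
      rcases hy : e.symm ⟨p.1 + 1, hp1⟩ with i' | j
      · have hi' := nexta hpx hy
        have := hD ⟨p.1, by omega⟩ (by
          rw [mem_shuffleDes]
          dsimp only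
          rw [hpx, hy]
          exact ⟨k, hk, rfl⟩)
        simp only [Function.comp_apply, hpx, hy, Sum.elim_inl] at this
        rwa [show i' = ⟨k + 1, by omega⟩ from Fin.ext hi'] at this
      · have h1 : Sum.elim f g (e.symm ⟨p.1, p.2⟩) ≤ Sum.elim f g (e.symm ⟨p.1 + 1, hp1⟩) :=
          hm (Fin.le_def.2 (Nat.le_succ _))
        have hne : (⟨p.1 + 1, hp1⟩ : Fin (a + b)) ≠ q := by
          intro h
          rw [h, hqx] at hy
          exact Sum.inl_ne_inr hy
        have h2 := sortKey_lt.1 (hs (lt_of_le_of_ne hle hne))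
        rw [hy, hqx] at h2
        rw [hy, hpx] at h1
        rcases h2 with h2 | ⟨-, h2⟩
        · exact lt_of_le_of_lt h1 h2
        · exact absurd h2 Sum.Lex.not_inr_lt_inl
    -- As before, except that for nonadjacent letters the strict increase occurs at the step from
    -- `p` to `p + 1`, from the second sequence to the first.
    · have hpq : e (Sum.inr ⟨k, by omega⟩) < e (Sum.inr ⟨k + 1, by omega⟩) :=
        heb (Fin.lt_def.2 (Nat.lt_succ_self _))
      set p := e (Sum.inr ⟨k, by omega⟩) with hp
      set q := e (Sum.inr ⟨k + 1, by omega⟩) with hq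
      have hpx : e.symm ⟨p.1, p.2⟩ = Sum.inr ⟨k, by omega⟩ := by rw [Equiv.symm_apply_eq]
      have hqx : e.symm q = Sum.inr ⟨k + 1, by omega⟩ := by rw [Equiv.symm_apply_eq]
      have hp1 : p.1 + 1 < a + b := by have := q.2; have : p.1 < q.1 := hpq; omega
      have hle : (⟨p.1 + 1, hp1⟩ : Fin (a + b)) ≤ q := hpq
      rcases hy : e.symm ⟨p.1 + 1, hp1⟩ with i | j'
      · have h1 := sortKey_lt.1 (hs (Fin.lt_def.2 (Nat.lt_succ_self p.1) :
          (⟨p.1, p.2⟩ : Fin (a + b)) < ⟨p.1 + 1, hp1⟩))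
        have h2 := hm hle
        simp only [Function.comp_apply] at h2
        rw [hy, hqx] at h2
        rw [hy, hpx] at h1
        rcases h1 with h1 | ⟨-, h1⟩
        · exact lt_of_lt_of_le h1 h2
        · exact absurd h1 Sum.Lex.not_inr_lt_inl
      · have hj' := nextb hpx hy
        have := hD ⟨p.1, by omega⟩ (by
          rw [mem_shuffleDes]
          dsimp only
          rw [hpx, hy]
          exact ⟨k, hk, rfl⟩)
        simp only [Function.comp_apply, hpx, hy, Sum.elim_inr] at this
        rwa [show j' = ⟨k + 1, by omega⟩ from Fin.ext hj'] at this
  · rintro ⟨⟨hf, hJ⟩, ⟨hg, hK⟩, hs⟩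
    have hm : Monotone (Sum.elim f g ∘ e.symm) := by
      intro x y hxy
      rcases hxy.eq_or_lt with rfl | h
      · exact le_rfl
      · rcases sortKey_lt.1 (hs h) with h1 | h1
        · exact h1.le
        · exact h1.1.le
    refine ⟨hm, fun k hk => ?_⟩
    have hlt := sortKey_lt.1 (hs (Fin.lt_def.2 (Nat.lt_succ_self k.1) :
      (⟨k.1, by omega⟩ : Fin (a + b)) < ⟨k.1 + 1, by omega⟩))
    rw [mem_shuffleDes] at hk
    dsimp only at hk
    rw [Function.comp_apply, Function.comp_apply]
    rcases hx : e.symm ⟨k.1, by omega⟩ with i | j <;>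
      rcases hy : e.symm ⟨k.1 + 1, by omega⟩ with i' | j' <;> rw [hx, hy] at hk hlt
    · obtain ⟨t, ht, hti⟩ := hk
      have hi' := nexta hx hy
      have := hJ t ht
      rwa [show (⟨t.1, by omega⟩ : Fin a) = i from Fin.ext hti,
        show (⟨t.1 + 1, by omega⟩ : Fin a) = i' from Fin.ext (by dsimp only; omega)] at this
    · exact hk.elim
    · rcases hlt with h | ⟨-, h⟩
      · exact h
      · exact absurd h Sum.Lex.not_inr_lt_inl
    · obtain ⟨t, ht, hti⟩ := hk
      have hi' := nextb hx hy
      have := hK t ht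
      rwa [show (⟨t.1, by omega⟩ : Fin b) = j from Fin.ext hti,
        show (⟨t.1 + 1, by omega⟩ : Fin b) = j' from Fin.ext (by dsimp only; omega)] at this

end SortKey

/-- Pairs of compatible sequences with a given total content. -/
abbrev CompatiblePair {a b : ℕ} (J : Finset (Fin (a - 1))) (K : Finset (Fin (b - 1)))
    (d : ℕ →₀ ℕ) : Type :=
  {p : (Fin a → ℕ) × (Fin b → ℕ) //
    Compatible J p.1 ∧ Compatible K p.2 ∧ content p.1 + content p.2 = d}

/-- Splitting a pair of sequences according to the two contents. -/
def compatiblePairEquiv {a b : ℕ} (J : Finset (Fin (a - 1))) (K : Finset (Fin (b - 1)))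
    (d : ℕ →₀ ℕ) : CompatiblePair J K d ≃
      Σ x : Finset.HasAntidiagonal.antidiagonal d, CompatibleSeq J x.1.1 × CompatibleSeq K x.1.2 where
  toFun p := ⟨⟨(content p.1.1, content p.1.2),
    Finset.HasAntidiagonal.mem_antidiagonal.2 p.2.2.2⟩, ⟨p.1.1, p.2.1, rfl⟩, ⟨p.1.2, p.2.2.1, rfl⟩⟩
  invFun q := ⟨(q.2.1.1, q.2.2.1), q.2.1.2.1, q.2.2.2.1, by
    rw [q.2.1.2.2, q.2.2.2.2]
    exact Finset.HasAntidiagonal.mem_antidiagonal.1 q.1.2⟩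
  left_inv _ := rfl
  right_inv := by
    rintro ⟨⟨⟨d₁, d₂⟩, h⟩, ⟨f, hf, hfd⟩, ⟨g, hg, hgd⟩⟩
    dsimp only at hfd hgd
    subst hfd hgd
    rfl

lemma sumElim_comp_shuffle {a b : ℕ} (e : Shuffle a b) (h : Fin (a + b) → ℕ) :
    Sum.elim (fun i => h (e.1 (Sum.inl i))) (fun j => h (e.1 (Sum.inr j))) ∘ e.1.symm = h := by
  funext k
  obtain ⟨x, rfl⟩ := e.1.surjective k
  rcases x with i | j <;> simp

/-- Taking a shuffled sequence apart. -/
def unshuffle {a b : ℕ} (J : Finset (Fin (a - 1))) (K : Finset (Fin (b - 1))) (d : ℕ →₀ ℕ)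
    (x : Σ e : Shuffle a b, CompatibleSeq (shuffleDes e J K) d) : CompatiblePair J K d :=
  ⟨(fun i => x.2.1 (x.1.1 (Sum.inl i)), fun j => x.2.1 (x.1.1 (Sum.inr j))), by
    obtain ⟨e, h, hc, hd⟩ := x
    dsimp only
    rw [← sumElim_comp_shuffle e h, compatible_shuffle_iff] at hc
    refine ⟨hc.1, hc.2.1, ?_⟩
    rw [← content_sumElim, ← hd]
    conv_rhs => rw [← sumElim_comp_shuffle e h]
    exact (content_comp_equiv e.1.symm _).symm⟩

/-- The order of the keys recovers the shuffle from the pair, which gives injectivity; sorting by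
keys gives surjectivity. -/
lemma unshuffle_bijective {a b : ℕ} (J : Finset (Fin (a - 1))) (K : Finset (Fin (b - 1)))
    (d : ℕ →₀ ℕ) : Function.Bijective (unshuffle J K d) := by
  constructor
  · rintro ⟨e, h, hc, hd⟩ ⟨e', h', hc', hd'⟩ heq
    have h1 : (fun i => h (e.1 (Sum.inl i))) = fun i => h' (e'.1 (Sum.inl i)) :=
      congrArg (fun p => p.1.1) heq
    have h2 : (fun i => h (e.1 (Sum.inr i))) = fun i => h' (e'.1 (Sum.inr i)) :=
      congrArg (fun p => p.1.2) heq
    have k1 := sumElim_comp_shuffle e h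
    have k2 := sumElim_comp_shuffle e' h'
    rw [← h1, ← h2] at k2
    have hee : e = e' := by
      have c1 := hc
      have c2 := hc'
      rw [← k1, compatible_shuffle_iff] at c1
      rw [← k2, compatible_shuffle_iff] at c2
      exact shuffle_unique c1.2.2 c2.2.2
    subst hee
    obtain rfl : h = h' := k1.symm.trans k2
    rfl
  · rintro ⟨⟨f, g⟩, hf, hg, hd⟩
    obtain ⟨e, he⟩ := exists_shuffle hf.1 hg.1
    refine ⟨⟨e, Sum.elim f g ∘ e.1.symm, (compatible_shuffle_iff e J K f g).2 ⟨hf, hg, he⟩, ?_⟩, ?_⟩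
    · rw [content_comp_equiv e.1.symm, content_sumElim, hd]
    · apply Subtype.ext
      simp [unshuffle]

/-- The product rule for fundamental quasisymmetric functions. -/
theorem L_mul_L {a b : ℕ} (J : Finset (Fin (a - 1))) (K : Finset (Fin (b - 1))) :
    QSym.L (QSym.compOfSet J) * QSym.L (QSym.compOfSet K) =
      ∑ e : Shuffle a b, QSym.L (QSym.compOfSet (shuffleDes e J K)) := by
  apply Subtype.ext
  ext d
  rw [MulMemClass.coe_mul, AddSubmonoidClass.coe_finsetSum, map_sum, MvPowerSeries.coeff_mul]
  simp only [coeff_L]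
  -- Both coefficients count pairs of compatible sequences of total content `d`, grouped by merging
  -- shuffle or by the two separate contents.
  have h := (Nat.card_congr (Equiv.ofBijective _ (unshuffle_bijective J K d))).trans
    (Nat.card_congr (compatiblePairEquiv J K d))
  simp only [Nat.card_sigma, Nat.card_prod] at h
  rw [← Finset.sum_coe_sort]
  exact_mod_cast h.symm

/-! ### Shuffles of the rows of alternating sign matrices -/

section IsShuffle

variable {X : Type} {a b : ℕ} {u : Fin a → X} {v : Fin b → X} {w : Fin (a + b) → X}

lemma isShuffle_iff : IsShuffle u v w ↔ ∃ e : Shuffle a b, ∀ x, w (e.1 x) = Sum.elim u v x := by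
  constructor
  · rintro ⟨f, g, hd, hf, hg⟩
    have hinj : Function.Injective (Sum.elim f g) :=
      f.injective.sumElim g.injective fun i j h =>
        Set.disjoint_left.1 hd ⟨i, rfl⟩ ⟨j, h.symm⟩
    have hbij : Function.Bijective (Sum.elim f g) :=
      (Fintype.bijective_iff_injective_and_card _).2 ⟨hinj, by simp⟩
    refine ⟨⟨Equiv.ofBijective _ hbij, f.strictMono, g.strictMono⟩, ?_⟩
    rintro (i | j)
    · exact hf i
    · exact hg j
  · rintro ⟨e, he⟩
    refine ⟨OrderEmbedding.ofStrictMono _ e.2.1, OrderEmbedding.ofStrictMono _ e.2.2, ?_,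
      fun i => he (Sum.inl i), fun j => he (Sum.inr j)⟩
    rw [Set.disjoint_left]
    rintro _ ⟨i, rfl⟩ ⟨j, h⟩
    exact Sum.inr_ne_inl (e.1.injective h)

/-- As `u` and `v` share no letter, `w` shows which positions belong to which sequence, and a
strictly increasing map is determined by its range. -/
lemma shuffle_eq (huv : ∀ i j, u i ≠ v j) {e e' : Shuffle a b}
    (h : ∀ x, w (e.1 x) = Sum.elim u v x) (h' : ∀ x, w (e'.1 x) = Sum.elim u v x) : e = e' := by
  have hl : ∀ {e : Shuffle a b}, (∀ x, w (e.1 x) = Sum.elim u v x) →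
      Set.range (fun i => e.1 (Sum.inl i)) = {k | ∃ i, w k = u i} := by
    intro e h
    ext k
    constructor
    · rintro ⟨i, rfl⟩
      exact ⟨i, h _⟩
    · rintro ⟨i, hi⟩
      obtain ⟨i' | j, rfl⟩ := e.1.surjective k
      · exact ⟨i', rfl⟩
      · exact absurd (hi.symm.trans (h _)) (huv i j)
  have hr : ∀ {e : Shuffle a b}, (∀ x, w (e.1 x) = Sum.elim u v x) →
      Set.range (fun i => e.1 (Sum.inr i)) = {k | ∃ j, w k = v j} := by
    intro e h
    ext k
    constructor
    · rintro ⟨i, rfl⟩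
      exact ⟨i, h _⟩
    · rintro ⟨j, hj⟩
      obtain ⟨i | j', rfl⟩ := e.1.surjective k
      · exact absurd ((h (Sum.inl i)).symm.trans hj) (huv i j)
      · exact ⟨j', rfl⟩
  have el := (StrictMono.range_inj e.2.1 e'.2.1).1 ((hl h).trans (hl h').symm)
  have er := (StrictMono.range_inj e.2.2 e'.2.2).1 ((hr h).trans (hr h').symm)
  apply Subtype.ext
  ext1 x
  rcases x with i | j
  · exact congrFun el i
  · exact congrFun er j

/-- Makes both products multiplicity-free sums indexed by `Shuffle a b`. -/
lemma sum_isShuffle {W N : Type*} [Fintype W] [AddCommMonoid N] {letters : W → Fin (a + b) → X}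
    (hinj : Function.Injective letters) (huv : ∀ i j, u i ≠ v j) {mk : Shuffle a b → W}
    (hmk : ∀ e x, letters (mk e) (e.1 x) = Sum.elim u v x)
    [DecidablePred fun w => IsShuffle u v (letters w)] (F : W → N) :
    ∑ w with IsShuffle u v (letters w), F w = ∑ e : Shuffle a b, F (mk e) := by
  symm
  refine Finset.sum_bij (fun e _ => mk e) (fun e _ => ?_) (fun e _ e' _ h => ?_) (fun w hw => ?_)
    (fun _ _ => rfl)
  · rw [Finset.mem_filter]
    exact ⟨Finset.mem_univ _, isShuffle_iff.2 ⟨e, hmk e⟩⟩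
  · refine shuffle_eq huv (hmk e) fun x => ?_
    rw [h]
    exact hmk e' x
  · obtain ⟨e, he⟩ := isShuffle_iff.1 (Finset.mem_filter.1 hw).2
    refine ⟨e, Finset.mem_univ _, hinj (funext fun k => ?_)⟩
    obtain ⟨x, rfl⟩ := e.1.surjective k
    rw [hmk, he]

end IsShuffle

/-- Inserting zeros preserves alternation; this serves both the rows and the columns of a shuffled
matrix. -/
lemma IsAlternating.extend {n m : ℕ} {v : Fin n → ℤ} (hv : IsAlternating v) {f : Fin n → Fin m}
    (hf : StrictMono f) {w : Fin m → ℤ} (hw : ∀ i, w (f i) = v i)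
    (h0 : ∀ k, k ∉ Set.range f → w k = 0) : IsAlternating w := by
  obtain ⟨h1, h2, ⟨i, hi, hi'⟩, ⟨j, hj, hj'⟩⟩ := hv
  have hne : ∀ {k}, w k ≠ 0 → ∃ i, f i = k := fun hk => by
    by_contra h
    exact hk (h0 _ h)
  refine ⟨fun k => ?_, fun k k' hk hwk hwk' hz => ?_, ⟨f i, (hw i).trans hi, fun k hk => ?_⟩,
    ⟨f j, (hw j).trans hj, fun k hk => ?_⟩⟩
  · by_cases hk : k ∈ Set.range f
    · obtain ⟨i, rfl⟩ := hk
      rw [hw]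
      exact h1 i
    · exact Or.inl (h0 k hk)
  · obtain ⟨x, rfl⟩ := hne hwk
    obtain ⟨y, rfl⟩ := hne hwk'
    rw [hw] at hwk hwk' ⊢
    rw [hw]
    exact h2 x y (hf.lt_iff_lt.1 hk) hwk hwk' fun z hz1 hz2 => by
      rw [← hw]
      exact hz _ (hf hz1) (hf hz2)
  · by_contra hwk
    obtain ⟨x, rfl⟩ := hne hwk
    rw [hw] at hwk
    exact hwk (hi' x (hf.lt_iff_lt.1 hk))
  · by_contra hwk
    obtain ⟨x, rfl⟩ := hne hwk
    rw [hw] at hwk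
    exact hwk (hj' x (hf.lt_iff_lt.1 hk))

/-! ### Products of basis elements as sums over shuffles. -/

section ShuffledASM

variable {a b : ℕ}

/-- The rows of `A ∘ b` and of `a ∘ B`. -/
def paddedRow (A : ASM a) (B : ASM b) : Fin a ⊕ Fin b → Fin (a + b) → ℤ :=
  Sum.elim (ASMAlg.padRight A b) (ASMAlg.padLeft a B)

lemma paddedRow_inl_castAdd (A : ASM a) (B : ASM b) (i j : Fin a) :
    paddedRow A B (Sum.inl i) (Fin.castAdd b j) = A.1 i j :=
  Fin.append_left (fun j => A.1 i j) (fun _ : Fin b => 0) j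

lemma paddedRow_inl_natAdd (A : ASM a) (B : ASM b) (i : Fin a) (j : Fin b) :
    paddedRow A B (Sum.inl i) (Fin.natAdd a j) = 0 :=
  Fin.append_right (fun j => A.1 i j) (fun _ : Fin b => 0) j

lemma paddedRow_inr_castAdd (A : ASM a) (B : ASM b) (i : Fin b) (j : Fin a) :
    paddedRow A B (Sum.inr i) (Fin.castAdd b j) = 0 :=
  Fin.append_left (fun _ : Fin a => 0) (fun j => B.1 i j) j

lemma paddedRow_inr_natAdd (A : ASM a) (B : ASM b) (i j : Fin b) :
    paddedRow A B (Sum.inr i) (Fin.natAdd a j) = B.1 i j :=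
  Fin.append_right (fun _ : Fin a => 0) (fun j => B.1 i j) j

lemma isAlternating_paddedRow (A : ASM a) (B : ASM b) (x : Fin a ⊕ Fin b) :
    IsAlternating (paddedRow A B x) := by
  rcases x with i | i
  · refine (A.2.1 i).extend (Fin.strictMono_castAdd b) (paddedRow_inl_castAdd A B i) fun k => ?_
    induction k using Fin.addCases with
    | left j => exact fun h => absurd ⟨j, rfl⟩ h
    | right j => exact fun _ => paddedRow_inl_natAdd A B i j
  · refine (B.2.1 i).extend (Fin.strictMono_natAdd a) (paddedRow_inr_natAdd A B i) fun k => ?_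
    induction k using Fin.addCases with
    | left j => exact fun _ => paddedRow_inr_castAdd A B i j
    | right j => exact fun h => absurd ⟨j, rfl⟩ h

/-- The alternating sign matrix obtained by shuffling the rows of `A ∘ b` and of `a ∘ B`. -/
def shuffledASM (A : ASM a) (B : ASM b) (e : Shuffle a b) : ASM (a + b) :=
  ⟨fun k => paddedRow A B (e.1.symm k), fun k => isAlternating_paddedRow A B _, fun j => by
    induction j using Fin.addCases with
    | left j =>
      refine (A.2.2 j).extend e.2.1 (fun i => ?_) fun k hk => ?_
      · exact (congrArg (paddedRow A B · _) (e.1.symm_apply_apply _)).trans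
            (paddedRow_inl_castAdd A B i j)
      · obtain ⟨i | i, rfl⟩ := e.1.surjective k
        · exact absurd ⟨i, rfl⟩ hk
        · exact (congrArg (paddedRow A B · _) (e.1.symm_apply_apply _)).trans
            (paddedRow_inr_castAdd A B i j)
    | right j =>
      refine (B.2.2 j).extend e.2.2 (fun i => ?_) fun k hk => ?_
      · exact (congrArg (paddedRow A B · _) (e.1.symm_apply_apply _)).trans
            (paddedRow_inr_natAdd A B i j)
      · obtain ⟨i | i, rfl⟩ := e.1.surjective k
        · exact (congrArg (paddedRow A B · _) (e.1.symm_apply_apply _)).trans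
            (paddedRow_inl_natAdd A B i j)
        · exact absurd ⟨i, rfl⟩ hk⟩

lemma shuffledASM_row (A : ASM a) (B : ASM b) (e : Shuffle a b) (k : Fin (a + b)) :
    (shuffledASM A B e).1 k = paddedRow A B (e.1.symm k) := rfl

lemma prefixSum_paddedRow_inl (A : ASM a) (B : ASM b) (i : Fin a) (c : ℕ) :
    prefixSum (paddedRow A B (Sum.inl i)) c = prefixSum (A.1 i) c := by
  rw [prefixSum, prefixSum, Finset.sum_filter, Finset.sum_filter, Fin.sum_univ_add]
  simp only [paddedRow_inl_castAdd, paddedRow_inl_natAdd, ite_self, Finset.sum_const_zero, add_zero,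
    Fin.val_castAdd]

/-- Truncated subtraction is what is needed: for `c ≤ a` only padding zeros are summed. -/
lemma prefixSum_paddedRow_inr (A : ASM a) (B : ASM b) (i : Fin b) (c : ℕ) :
    prefixSum (paddedRow A B (Sum.inr i)) c = prefixSum (B.1 i) (c - a) := by
  rw [prefixSum, prefixSum, Finset.sum_filter, Finset.sum_filter, Fin.sum_univ_add]
  simp only [paddedRow_inr_castAdd, paddedRow_inr_natAdd, ite_self, Finset.sum_const_zero, zero_add,
    Fin.val_natAdd]
  exact Finset.sum_congr rfl fun j _ => if_congr (by omega) rfl rfl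

lemma asmDes_shuffledASM (A : ASM a) (B : ASM b) (e : Shuffle a b) :
    asmDes (shuffledASM A B e) = shuffleDes e (asmDes A) (asmDes B) := by
  ext k
  rw [mem_asmDes, mem_shuffleDes, shuffledASM_row, shuffledASM_row]
  rcases hx : e.1.symm ⟨k.1, by omega⟩ with i | j <;>
    rcases hy : e.1.symm ⟨k.1 + 1, by omega⟩ with i' | j' <;>
    simp only [prefixSum_paddedRow_inl, prefixSum_paddedRow_inr, LetterDes, iff_true, iff_false]
  · rw [Equiv.symm_apply_eq] at hx hy
    have h := next_of_strictMono e.2.1 (show (e.1 (Sum.inl i')).1 = (e.1 (Sum.inl i)).1 + 1 by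
      rw [← hx, ← hy])
    constructor
    · rintro ⟨c, h1, h2⟩
      refine ⟨⟨i.1, by omega⟩, (mem_asmDes A _).2 ⟨c, h1, ?_⟩, rfl⟩
      rwa [show (⟨i.1 + 1, by omega⟩ : Fin a) = i' from Fin.ext h.symm]
    · rintro ⟨t, ht, hti⟩
      obtain ⟨c, h1, h2⟩ := (mem_asmDes A t).1 ht
      rw [show (⟨t.1, by omega⟩ : Fin a) = i from Fin.ext hti] at h1
      rw [show (⟨t.1 + 1, by omega⟩ : Fin a) = i' from Fin.ext (by dsimp only; omega)] at h2
      exact ⟨c, h1, h2⟩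
  -- A vanishing prefix sum of the row of `A` forces `c < a`, but then the row of `B` has not
  -- started.
  · rintro ⟨c, h1, h2⟩
    rcases le_total a c with h | h
    · rw [prefixSum_of_le _ h, (A.2.1 i).sum_eq_one] at h1
      exact one_ne_zero h1
    · rw [Nat.sub_eq_zero_of_le h, prefixSum_zero] at h2
      exact zero_ne_one h2
  -- At the border of the two column blocks the row of `B` has sum 0 and the row of `A` its full sum
  -- 1.
  · refine ⟨a, ?_, ?_⟩
    · rw [Nat.sub_self, prefixSum_zero]
    · rw [prefixSum_of_le _ le_rfl, (A.2.1 i').sum_eq_one]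
  · rw [Equiv.symm_apply_eq] at hx hy
    have h := next_of_strictMono e.2.2 (show (e.1 (Sum.inr j')).1 = (e.1 (Sum.inr j)).1 + 1 by
      rw [← hx, ← hy])
    constructor
    · rintro ⟨c, h1, h2⟩
      refine ⟨⟨j.1, by omega⟩, (mem_asmDes B _).2 ⟨c - a, h1, ?_⟩, rfl⟩
      rwa [show (⟨j.1 + 1, by omega⟩ : Fin b) = j' from Fin.ext h.symm]
    · rintro ⟨t, ht, hti⟩
      obtain ⟨c, h1, h2⟩ := (mem_asmDes B t).1 ht
      rw [show (⟨t.1, by omega⟩ : Fin b) = j from Fin.ext hti] at h1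
      rw [show (⟨t.1 + 1, by omega⟩ : Fin b) = j' from Fin.ext (by dsimp only; omega)] at h2
      refine ⟨c + a, ?_, ?_⟩ <;> rwa [Nat.add_sub_cancel]

/-- Each row of `A` has an entry 1, in a column where padded rows of `B` vanish. -/
lemma padRight_ne_padLeft (A : ASM a) (B : ASM b) (i : Fin a) (j : Fin b) :
    ASMAlg.padRight A b i ≠ ASMAlg.padLeft a B j := by
  obtain ⟨c, hc, -⟩ := (A.2.1 i).2.2.1
  intro h
  have h1 := congrFun h (Fin.castAdd b c)
  have h2 := paddedRow_inl_castAdd A B i c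
  have h3 := paddedRow_inr_castAdd A B j c
  exact one_ne_zero (hc.symm.trans (h2.symm.trans (h1.trans h3)))

lemma ASMAlg.of_mul_of (A : ASM a) (B : ASM b) :
    ASMAlg.of A * ASMAlg.of B = ∑ e : Shuffle a b, ASMAlg.of (shuffledASM A B e) := by
  have h : ASMAlg.of A * ASMAlg.of B = ASMAlg.shuffleProd A B := by
    change ASMAlg.mulHom (ASMAlg.of A) (ASMAlg.of B) = _
    rw [ASMAlg.mulHom, ASMAlg.of, Module.Basis.constr_basis, ASMAlg.of, Module.Basis.constr_basis]
  rw [h, ASMAlg.shuffleProd]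
  classical
  refine sum_isShuffle (letters := fun (C : ASM (a + b)) i j => C.1 i j)
    (fun C D h => Subtype.ext h) (padRight_ne_padLeft A B) (fun e x => ?_) _
  change paddedRow A B (e.1.symm (e.1 x)) = _
  rw [Equiv.symm_apply_apply]
  rfl

/-- The permutation obtained by shuffling `u` and the shift of `v` by `a`. -/
def shuffledPerm (u : Equiv.Perm (Fin a)) (v : Equiv.Perm (Fin b)) (e : Shuffle a b) :
    Equiv.Perm (Fin (a + b)) :=
  e.1.symm.trans ((Equiv.sumCongr u v).trans finSumFinEquiv)

lemma FQSym.of_mul_of (u : Equiv.Perm (Fin a)) (v : Equiv.Perm (Fin b)) :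
    FQSym.of u * FQSym.of v = ∑ e : Shuffle a b, FQSym.of (shuffledPerm u v e) := by
  have h : FQSym.of u * FQSym.of v = FQSym.shuffleProd u v := by
    change FQSym.mulHom (FQSym.of u) (FQSym.of v) = _
    rw [FQSym.mulHom, FQSym.of, Module.Basis.constr_basis, FQSym.of, Module.Basis.constr_basis]
  rw [h, FQSym.shuffleProd]
  classical
  refine sum_isShuffle (letters := fun (w : Equiv.Perm (Fin (a + b))) k => w k)
    (fun w w' h => Equiv.ext (congrFun h)) (fun i j h => ?_) (fun e x => ?_) _
  · have := congrArg Fin.val h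
    simp only [Fin.val_castAdd, Fin.val_natAdd] at this
    omega
  · rw [shuffledPerm, Equiv.trans_apply, Equiv.symm_apply_apply]
    rcases x with i | j <;> simp

lemma permASM_shuffledPerm (u : Equiv.Perm (Fin a)) (v : Equiv.Perm (Fin b)) (e : Shuffle a b) :
    permASM (shuffledPerm u v e) = shuffledASM (permASM u) (permASM v) e := by
  apply Subtype.ext
  ext k j
  rw [shuffledASM_row]
  change (if j = shuffledPerm u v e k then (1 : ℤ) else 0) = _
  rw [shuffledPerm, Equiv.trans_apply]
  rcases e.1.symm k with i | i <;> induction j using Fin.addCases with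
  | left j => simp [paddedRow_inl_castAdd, paddedRow_inr_castAdd, permASM, Fin.ext_iff] <;> try omega
  | right j => simp [paddedRow_inl_natAdd, paddedRow_inr_natAdd, permASM, Fin.ext_iff] <;> try omega

end ShuffledASM

/-! ### The morphisms -/

lemma asmDesMap_of {n : ℕ} (A : ASM n) :
    asmDesMap (ASMAlg.of A) = QSym.L (QSym.compOfSet (asmDes A)) := by
  rw [asmDesMap, ASMAlg.of, Module.Basis.constr_basis]

lemma permDesMap_of {n : ℕ} (w : Equiv.Perm (Fin n)) :
    permDesMap (FQSym.of w) = QSym.L (QSym.compOfSet (permDes w)) := by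
  rw [permDesMap, FQSym.of, Module.Basis.constr_basis]

lemma permEmbedding_of {n : ℕ} (w : Equiv.Perm (Fin n)) :
    permEmbedding (FQSym.of w) = ASMAlg.of (permASM w) := by
  rw [permEmbedding, FQSym.of, Module.Basis.constr_basis]

lemma L_compOfSet_zero (J : Finset (Fin (0 - 1))) : QSym.L (QSym.compOfSet J) = 1 := by
  apply Subtype.ext
  ext d
  rw [coeff_L, OneMemClass.coe_one, MvPowerSeries.coeff_one]
  split_ifs with h
  · have : Nonempty (CompatibleSeq J d) :=
      ⟨⟨Fin.elim0, ⟨fun i => i.elim0, fun k => k.elim0⟩, by rw [h]; rfl⟩⟩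
    have : Unique (CompatibleSeq J d) := uniqueOfSubsingleton this.some
    rw [Nat.card_unique, Nat.cast_one]
  · have : IsEmpty (CompatibleSeq J d) := ⟨fun f => h (f.2.2.symm.trans rfl)⟩
    rw [Nat.card_of_isEmpty, Nat.cast_zero]

lemma asmDesMap_one : asmDesMap 1 = 1 :=
  (asmDesMap_of emptyASM).trans (L_compOfSet_zero _)

lemma asmDesMap_mul (x y : ASMAlg) : asmDesMap (x * y) = asmDesMap x * asmDesMap y := by
  have h : ASMAlg.mulHom.compr₂ asmDesMap =
      (LinearMap.mul ℤ QSym).compl₁₂ asmDesMap asmDesMap := by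
    refine ASMAlg.basis.ext fun A => ASMAlg.basis.ext fun B => ?_
    change asmDesMap (ASMAlg.of A.2 * ASMAlg.of B.2) =
      asmDesMap (ASMAlg.of A.2) * asmDesMap (ASMAlg.of B.2)
    rw [ASMAlg.of_mul_of, map_sum, asmDesMap_of, asmDesMap_of, L_mul_L]
    exact Finset.sum_congr rfl fun e _ => by rw [asmDesMap_of, asmDes_shuffledASM]
  exact LinearMap.congr_fun₂ h x y

lemma permEmbedding_mul (x y : FQSym) :
    permEmbedding (x * y) = permEmbedding x * permEmbedding y := by
  have h : FQSym.mulHom.compr₂ permEmbedding =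
      ASMAlg.mulHom.compl₁₂ permEmbedding permEmbedding := by
    refine FQSym.basis.ext fun u => FQSym.basis.ext fun v => ?_
    change permEmbedding (FQSym.of u.2 * FQSym.of v.2) =
      permEmbedding (FQSym.of u.2) * permEmbedding (FQSym.of v.2)
    rw [FQSym.of_mul_of, map_sum, permEmbedding_of, permEmbedding_of, ASMAlg.of_mul_of]
    exact Finset.sum_congr rfl fun e _ => by rw [permEmbedding_of, permASM_shuffledPerm]
  exact LinearMap.congr_fun₂ h x y

lemma permEmbedding_one : permEmbedding 1 = 1 := by
  refine (permEmbedding_of _).trans ?_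
  change ASMAlg.of (permASM 1) = ASMAlg.of emptyASM
  congr 1
  exact Subtype.ext (funext fun i => i.elim0)

lemma permASM_injective {n : ℕ} : Function.Injective (permASM (n := n)) := by
  intro u v h
  ext1 i
  have h1 : (if u i = u i then (1 : ℤ) else 0) = if u i = v i then 1 else 0 :=
    congrFun (congrFun (congrArg Subtype.val h) i) (u i)
  by_contra hne
  rw [if_pos rfl, if_neg hne] at h1
  exact one_ne_zero h1

lemma permEmbedding_injective : Function.Injective permEmbedding := by
  have hinj : Function.Injective
      (fun w : Σ n, Equiv.Perm (Fin n) => (⟨w.1, permASM w.2⟩ : Σ n, ASM n)) := by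
    rintro ⟨n, u⟩ ⟨m, v⟩ h
    obtain rfl : n = m := congrArg Sigma.fst h
    obtain rfl : u = v := permASM_injective (eq_of_heq (Sigma.mk.inj h).2)
    rfl
  have hli := ASMAlg.basis.linearIndependent.comp _ hinj
  exact FQSym.basis.injective_constr_of_linearIndependent hli

lemma asmDesMap_permEmbedding (x : FQSym) : asmDesMap (permEmbedding x) = permDesMap x := by
  have h : asmDesMap ∘ₗ permEmbedding = permDesMap := by
    refine FQSym.basis.ext fun w => ?_
    change asmDesMap (permEmbedding (FQSym.of w.2)) = permDesMap (FQSym.of w.2)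
    rw [permEmbedding_of, asmDesMap_of, permDesMap_of, asmDes_permASM]
  exact LinearMap.congr_fun h x

/-! ### Failure of compatibility with the coproducts -/

lemma coord_M (γ β : Comp) : QSym.basis.coord γ (QSym.M β) = if β = γ then 1 else 0 := by
  rw [QSym.M, Module.Basis.coord_apply, Module.Basis.repr_self, Finsupp.single_apply]

lemma coord_L_eq_zero {n : ℕ} (α : Composition n) {γ : Comp} (h : n ≠ γ.1.sum) :
    QSym.basis.coord γ (QSym.L α) = 0 := by
  rw [QSym.L, map_sum]
  refine Finset.sum_eq_zero fun β _ => ?_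
  rw [coord_M]
  refine if_neg fun hβ => h ?_
  rw [← hβ]
  exact β.blocks_sum.symm

/-- The functional on `QSym ⊗ QSym` that reads off the coefficient of `M_β ⊗ M_γ`. -/
def coordTensor (β γ : Comp) : QSym ⊗[ℤ] QSym →ₗ[ℤ] ℤ :=
  LinearMap.mul' ℤ ℤ ∘ₗ TensorProduct.map (QSym.basis.coord β) (QSym.basis.coord γ)

lemma coordTensor_tmul (β γ : Comp) (x y : QSym) :
    coordTensor β γ (x ⊗ₜ y) = QSym.basis.coord β x * QSym.basis.coord γ y := rfl

lemma comul_M (α : Comp) :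
    (CoalgebraStruct.comul : QSym →ₗ[ℤ] QSym ⊗[ℤ] QSym) (QSym.M α) = QSym.deconcat α :=
  Module.Basis.constr_basis _ _ _ _

lemma comul_of {n : ℕ} (A : ASM n) :
    (CoalgebraStruct.comul : ASMAlg →ₗ[ℤ] ASMAlg ⊗[ℤ] ASMAlg) (ASMAlg.of A) =
      ASMAlg.cutCoprod A :=
  Module.Basis.constr_basis _ _ _ _

/-- Rules out cancellation among the coproducts of the `M` that make up an `L`. -/
lemma coordTensor_deconcat_nonneg (β γ α : Comp) : 0 ≤ coordTensor β γ (QSym.deconcat α) := by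
  rw [QSym.deconcat, map_sum]
  refine Finset.sum_nonneg fun k _ => ?_
  rw [coordTensor_tmul, coord_M, coord_M]
  split_ifs <;> norm_num

lemma boundaries_ones (n : ℕ) (t : Fin (n + 1)) : t ∈ (Composition.ones n).boundaries := by
  rw [Composition.boundaries, Finset.mem_map]
  refine ⟨Fin.cast (by simp) t, Finset.mem_univ _, Fin.ext ?_⟩
  change (Composition.ones n).sizeUpTo t.1 = t.1
  rw [Composition.ones_sizeUpTo]
  exact min_eq_left (by omega)

/-- The composition `(1)`. -/
def compOne : Comp := ⟨[1], by simp⟩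

/-- The composition `(1, 1)`. -/
def compOneOne : Comp := ⟨[1, 1], by simp⟩

/-- The composition (1, 1, 1) refines every composition of 3, and its deconcatenation after the
first part is (1) and (1, 1). -/
lemma coordTensor_comul_L_pos (α : Composition 3) :
    0 < coordTensor compOne compOneOne
      ((CoalgebraStruct.comul : QSym →ₗ[ℤ] QSym ⊗[ℤ] QSym) (QSym.L α)) := by
  rw [QSym.L, map_sum, map_sum]
  refine Finset.sum_pos' (fun β _ => ?_) ⟨Composition.ones 3, ?_, ?_⟩
  · rw [comul_M]
    exact coordTensor_deconcat_nonneg _ _ _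
  · rw [Finset.mem_filter]
    exact ⟨Finset.mem_univ _, fun t _ => boundaries_ones 3 t⟩
  · rw [comul_M, QSym.deconcat, map_sum]
    refine Finset.sum_pos' (fun k _ => ?_) ⟨1, ?_, ?_⟩
    · rw [coordTensor_tmul, coord_M, coord_M]
      split_ifs <;> norm_num
    · rw [Finset.mem_range]
      exact Nat.succ_lt_succ (by decide : 0 < (Composition.ones 3).blocks.length)
    · rw [coordTensor_tmul, coord_M, coord_M, if_pos (by rfl), if_pos (by rfl)]
      norm_num

/-- The entries of the `3 × 3` alternating sign matrix that is not a permutation matrix. -/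
def diamondEntries : Fin 3 → Fin 3 → ℤ := ![![0, 1, 0], ![1, -1, 1], ![0, 1, 0]]

/-- The `3 × 3` alternating sign matrix that is not a permutation matrix. -/
def diamondASM : ASM 3 := ⟨diamondEntries, by
  change (∀ i, IsAlternating fun j => diamondEntries i j) ∧
    ∀ j, IsAlternating fun i => diamondEntries i j
  unfold diamondEntries
  refine ⟨fun i => ⟨?_, ?_, ?_, ?_⟩, fun i => ⟨?_, ?_, ?_, ?_⟩⟩ <;> revert i <;> dsimp only <;>
    decide⟩

/-- Every cut other than the one below the first row has a left factor of degree different from 1,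
and that cut is not allowed. -/
lemma coordTensor_comul_diamond :
    coordTensor compOne compOneOne (TensorProduct.map asmDesMap asmDesMap
      ((CoalgebraStruct.comul : ASMAlg →ₗ[ℤ] ASMAlg ⊗[ℤ] ASMAlg) (ASMAlg.of diamondASM))) = 0 := by
  classical
  rw [comul_of, ASMAlg.cutCoprod]
  simp only [map_sum]
  refine Finset.sum_eq_zero fun p _ => Finset.sum_eq_zero fun B _ => Finset.sum_eq_zero fun C _ => ?_
  split_ifs with h
  · rw [TensorProduct.map_tmul, coordTensor_tmul, asmDesMap_of]
    by_cases hp : p.1 = 1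
    · exfalso
      obtain ⟨f, hf, -⟩ := h.2
      obtain rfl : p = 1 := Fin.ext hp
      -- The middle row 1, -1, 1 lies in the bottom block and has no zero, so all three columns
      -- survive, though the block has only two rows.
      have hsurj : Function.Surjective f := by
        rw [← Set.range_eq_univ, hf, Set.eq_univ_iff_forall]
        intro c
        refine ⟨⟨0, by decide⟩, ?_⟩
        change diamondEntries 1 c ≠ 0
        revert c
        unfold diamondEntries
        decide
      have := Fintype.card_le_of_surjective f hsurj
      revert this
      simp
    · rw [coord_L_eq_zero _ (by simpa [compOne] using hp), zero_mul]
  · rw [map_zero, map_zero]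

lemma not_map_comp_comul_eq :
    ¬ (TensorProduct.map asmDesMap asmDesMap ∘ₗ (CoalgebraStruct.comul : ASMAlg →ₗ[ℤ] _) =
      (CoalgebraStruct.comul : QSym →ₗ[ℤ] _) ∘ₗ asmDesMap) := by
  intro h
  have h1 := congrArg (coordTensor compOne compOneOne)
    (LinearMap.congr_fun h (ASMAlg.of diamondASM))
  have h2 := coordTensor_comul_L_pos (QSym.compOfSet (asmDes diamondASM))
  rw [LinearMap.comp_apply, LinearMap.comp_apply, coordTensor_comul_diamond, asmDesMap_of] at h1
  exact h2.ne h1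

end ASMHopf

end

theorem theorem3 :
    -- `A ↦ L_{α(Des(A))}` is a morphism of algebras,
    (ASMHopf.asmDesMap 1 = 1 ∧
      ∀ x y : ASMHopf.ASMAlg,
        ASMHopf.asmDesMap (x * y) = ASMHopf.asmDesMap x * ASMHopf.asmDesMap y) ∧
    -- it extends the map `w ↦ L_{α(Des(w))}` along the embedding of algebras `w ↦ A(w)`,
    (Function.Injective ASMHopf.permEmbedding ∧
      ASMHopf.permEmbedding 1 = 1 ∧
      (∀ x y : ASMHopf.FQSym,
        ASMHopf.permEmbedding (x * y) = ASMHopf.permEmbedding x * ASMHopf.permEmbedding y) ∧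
      ∀ x : ASMHopf.FQSym,
        ASMHopf.asmDesMap (ASMHopf.permEmbedding x) = ASMHopf.permDesMap x) ∧
    -- and it is not compatible with the coproducts.
    ¬ (TensorProduct.map ASMHopf.asmDesMap ASMHopf.asmDesMap ∘ₗ
        (CoalgebraStruct.comul : ASMHopf.ASMAlg →ₗ[ℤ] _) =
      (CoalgebraStruct.comul : ASMHopf.QSym →ₗ[ℤ] _) ∘ₗ ASMHopf.asmDesMap) := by
  exact ⟨⟨ASMHopf.asmDesMap_one, ASMHopf.asmDesMap_mul⟩,
    ⟨ASMHopf.permEmbedding_injective, ASMHopf.permEmbedding_one, ASMHopf.permEmbedding_mul,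
      ASMHopf.asmDesMap_permEmbedding⟩,
    ASMHopf.not_map_comp_comul_eq⟩
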